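/- **Conventions.** An operator algebra is a norm-closed subalgebra of the bounded operators on a complex Hilbert space (not necessarily unital or selfadjoint), regarded up to completely isometric isomorphism as a complex Banach algebra $A$ with the inherited norms on the matrix spaces $M_n(A)$. A morphism is a completely contractive homomorphism, and $\mathrm{Mor}(A,B)$ is the set of morphisms $A\to B$. An operator algebra is unital if it has an identity of norm $1$, and approximately unital if it has a contractive two-sided approximate identity. For an approximately unital $A$, $\mathcal M(A)$ is the multiplier algebra, i.e. the algebra of double centralizers of $A$, with the norm on $M_n(\mathcal M(A))$ being the operator norm of left multiplication on $M_n(A)$; $\mathcal Q(A)=\mathcal M(A)/A$ is the corona algebra with the quotient matrix norms, and $\pi_A:\mathcal M(A)\to\mathcal Q(A)$ is the quotient map. Let $A$ and $C$ be nontrivial (nonzero) operator algebras with $A$ approximately unital. An extension $E$ of $C$ by $A$ is an exact sequence $0\to A\xrightarrow{\alpha}B\xrightarrow{\beta}C\to0$ in which $B$ is an operator algebra, $\alpha$ is a completely isometric homomorphism and $\beta$ is a homomorphism that is a complete quotient map. Two extensions of $C$ by $A$, with middle terms $B_1,B_2$, are strongly isomorphic if there is a surjective completely isometric homomorphism $B_1\to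 B_2$ that commutes with the maps from $A$ and the maps to $C$; $\mathbf{Ext}(C,A)$ is the set of strong isomorphism classes. The extension $E$ splits if there is $\gamma\in\mathrm{Mor}(C,B)$ with $\beta\gamma=I_C$, and it is unital if $B$ is unital. The Busby invariant of $E$ is the morphism $\tau:C\to\mathcal Q(A)$, $\tau(\beta(b))=\pi_A(\sigma(b))$, where $\sigma:B\to\mathcal M(A)$ is the canonical morphism, $\sigma(b)(a)=\alpha^{-1}(b\,\alpha(a))$. For $\tau\in\mathrm{Mor}(C,\mathcal Q(A))$, the pullback extension constructed from $\tau$ has middle term $\{(m,c)\in\mathcal M(A)\oplus^\infty C:\pi_A(m)=\tau(c)\}$ and maps $a\mapsto(a,0)$ and $(m,c)\mapsto c$. **Theorem 3.3.** Let $A$ and $C$ be nontrivial operator algebras with $A$ approximately unital. 1. The map sending an extension to its Busby invariant induces a bijection $\mathbf{Ext}(C,A)\to\mathrm{Mor}(C,\mathcal Q(A))$. Its inverse is given by the pullback extension: an extension $E$ has Busby invariant $\tau$ if and only if it is strongly isomorphic to the pullback extension constructed from $\tau$. 2. An extension of $C$ by $A$ splits if and only if its Busby invariant equals $\pi_A\circ\eta$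 for some $\eta\in\mathrm{Mor}(C,\mathcal M(A))$. Accordingly, there is a map $\mathrm{Mor}(C,\mathcal M(A))\to\mathbf{Ext}(C,A)$, taking $\eta$ to a class with Busby invariant $\pi_A\circ\eta$, whose range is exactly the set of classes of split extensions. This correspondence is not bijective in general: for $C=A$ there are $\eta_1\neq\eta_2$ in $\mathrm{Mor}(A,\mathcal M(A))$ with $\pi_A\circ\eta_1=\pi_A\circ\eta_2$. 3. If $C$ is unital, the bijection in 1 restricts to a bijection between the classes of unital extensions and the unital morphisms, i.e. the $\tau\in\mathrm{Mor}(C,\mathcal Q(A))$ with $\tau(1)=1$. -/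

import Mathlib

open scoped MultiplierAlgebra

universe u

/-! ### Operator algebras and their morphisms -/

/-- The operator on the Hilbert space direct sum `Hⁿ` given by an `n × n` matrix of bounded
operators on `H`. -/
noncomputable def matrixOp {H : Type u} [NormedAddCommGroup H] [InnerProductSpace ℂ H] {n : ℕ}
    (T : Matrix (Fin n) (Fin n) (H →L[ℂ] H)) :
    PiLp 2 (fun _ : Fin n => H) →L[ℂ] PiLp 2 (fun _ : Fin n => H) :=
  ((PiLp.continuousLinearEquiv 2 ℂ (fun _ : Fin n => H)).symm :
      (Fin n → H) →L[ℂ] PiLp 2 (fun _ : Fin n => H)) ∘L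
    (ContinuousLinearMap.pi fun i => ∑ j, (T i j) ∘L ContinuousLinearMap.proj j) ∘L
    ((PiLp.continuousLinearEquiv 2 ℂ (fun _ : Fin n => H)) :
      PiLp 2 (fun _ : Fin n => H) →L[ℂ] (Fin n → H))

/-- A family of (candidate) norms on the matrix spaces `Mₙ(A)`. -/
class MatrixNorms (A : Type u) where
  mnorm : (n : ℕ) → Matrix (Fin n) (Fin n) A → ℝ

open MatrixNorms (mnorm)

/-- A (not necessarily unital) operator algebra: a complete normed complex algebra with matrix
norms, the first of which is the given norm, that is completely isometrically isomorphic to a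
(norm closed) subalgebra of the bounded operators on a Hilbert space. -/
class OperatorAlgebra (A : Type u) extends NonUnitalNormedRing A, CompleteSpace A,
    NormedSpace ℂ A, IsScalarTower ℂ A A, SMulCommClass ℂ A A, MatrixNorms A where
  mnorm_one : ∀ a : A, mnorm 1 (Matrix.of fun _ _ => a) = ‖a‖
  exists_rep : ∃ (H : Type u) (_ : NormedAddCommGroup H) (_ : InnerProductSpace ℂ H)
    (_ : CompleteSpace H) (π : A →ₙₐ[ℂ] (H →L[ℂ] H)),
    ∀ (n : ℕ) (x : Matrix (Fin n) (Fin n) A), mnorm n x = ‖matrixOp (x.map π)‖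

/-- `A` has a contractive two-sided approximate identity. -/
class ApproximatelyUnital (A : Type u) [OperatorAlgebra A] : Prop where
  exists_cai : ∃ l : Filter A, l.IsApproximateUnit ∧ ∀ᶠ e in l, ‖e‖ ≤ 1

/-- `e` is an identity of norm one. -/
def IsUnitElement {A : Type u} [OperatorAlgebra A] (e : A) : Prop :=
  ‖e‖ = 1 ∧ ∀ a : A, e * a = a ∧ a * e = a

/-- `A` is unital: it has an identity of norm one. -/
def IsUnital (A : Type u) [OperatorAlgebra A] : Prop :=
  ∃ e : A, IsUnitElement e

section Maps

variable {A B : Type u} [NonUnitalNonAssocSemiring A] [DistribMulAction ℂ A] [MatrixNorms A]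
  [NonUnitalNonAssocSemiring B] [DistribMulAction ℂ B] [MatrixNorms B]

def CompletelyContractive (φ : A →ₙₐ[ℂ] B) : Prop :=
  ∀ (n : ℕ) (x : Matrix (Fin n) (Fin n) A), mnorm n (x.map φ) ≤ mnorm n x

def CompletelyIsometric (φ : A →ₙₐ[ℂ] B) : Prop :=
  ∀ (n : ℕ) (x : Matrix (Fin n) (Fin n) A), mnorm n (x.map φ) = mnorm n x

/-- At each matrix level, the image of each open ball about zero is the open ball of the same
radius. -/
def IsCompleteQuotientMap (φ : A →ₙₐ[ℂ] B) : Prop :=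
  CompletelyContractive φ ∧
    ∀ (n : ℕ) (y : Matrix (Fin n) (Fin n) B) (r : ℝ), mnorm n y < r →
      ∃ x : Matrix (Fin n) (Fin n) A, x.map φ = y ∧ mnorm n x < r

end Maps

/-- The set of morphisms, i.e. of completely contractive homomorphisms. -/
def Mor (A B : Type u) [NonUnitalNonAssocSemiring A] [DistribMulAction ℂ A] [MatrixNorms A]
    [NonUnitalNonAssocSemiring B] [DistribMulAction ℂ B] [MatrixNorms B] : Type u :=
  {φ : A →ₙₐ[ℂ] B // CompletelyContractive φ}

/-! ### The multiplier algebra and the corona algebra -/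

section Multiplier

variable (A : Type u) [OperatorAlgebra A]

/-- The matrix norms of the multiplier algebra `𝓜(ℂ, A)` (whose elements are the double
centralizers of `A`): the norm of `x ∈ Mₙ(𝓜(ℂ, A))` is the norm of the operator `a ↦ x a` of left
multiplication by `x` on `Mₙ(A)`. -/
noncomputable instance multiplierMatrixNorms : MatrixNorms 𝓜(ℂ, A) where
  mnorm n x := sInf {K : ℝ | 0 ≤ K ∧ ∀ a : Matrix (Fin n) (Fin n) A,
    mnorm n (Matrix.of fun i j => ∑ k, (x i k).fst (a k j)) ≤ K * mnorm n a}

variable [ApproximatelyUnital A]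

theorem eq_of_forall_mul_left {A : Type u} [OperatorAlgebra A] [ApproximatelyUnital A] {y z : A}
    (h : ∀ x : A, x * y = x * z) : y = z := by
  obtain ⟨l, hl, -⟩ := ApproximatelyUnital.exists_cai (A := A)
  have := hl.neBot
  refine tendsto_nhds_unique (hl.tendsto_mul_right y) ?_
  simpa only [h] using hl.tendsto_mul_right z

theorem eq_of_forall_mul_right {A : Type u} [OperatorAlgebra A] [ApproximatelyUnital A] {y z : A}
    (h : ∀ x : A, y * x = z * x) : y = z := by
  obtain ⟨l, hl, -⟩ := ApproximatelyUnital.exists_cai (A := A)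
  have := hl.neBot
  refine tendsto_nhds_unique (hl.tendsto_mul_left y) ?_
  simpa only [h] using hl.tendsto_mul_left z

/-- The copy of `A` in `𝓜(ℂ, A)`, as an ideal. -/
noncomputable def multiplierIdeal : Ideal 𝓜(ℂ, A) where
  carrier := {m | ∃ a : A, (a : 𝓜(ℂ, A)) = m}
  add_mem' := by
    rintro _ _ ⟨a, rfl⟩ ⟨b, rfl⟩
    refine ⟨a + b, ?_⟩
    ext x <;> simp
  zero_mem' := by
    refine ⟨0, ?_⟩
    ext x <;> simp
  smul_mem' := by
    rintro m _ ⟨a, rfl⟩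
    refine ⟨m.fst a, ?_⟩
    ext x
    · refine eq_of_forall_mul_left fun z => ?_
      have h1 := m.central z (a * x)
      have h2 := m.central z a
      simp only [DoubleCentralizer.coe_fst, ContinuousLinearMap.mul_apply', smul_eq_mul,
        DoubleCentralizer.mul_fst, mul_apply_eq_comp]
      rw [← h1, ← mul_assoc, ← mul_assoc, h2]
    · simpa using (m.central x a).symm

instance multiplierIdeal_isTwoSided : (multiplierIdeal A).IsTwoSided where
  mul_mem_of_left := by
    rintro _ m ⟨a, rfl⟩
    refine ⟨m.snd a, ?_⟩
    ext x
    · simpa using m.central a x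
    · refine eq_of_forall_mul_right fun z => ?_
      have h1 := m.central (x * a) z
      have h2 := m.central a z
      simp only [DoubleCentralizer.coe_snd, ContinuousLinearMap.flip_apply,
        ContinuousLinearMap.mul_apply', DoubleCentralizer.mul_snd, mul_apply_eq_comp]
      rw [h1, mul_assoc, mul_assoc, h2]

/-- The corona algebra `𝓠(A) = 𝓜(A) / A`. -/
abbrev Corona : Type u := 𝓜(ℂ, A) ⧸ multiplierIdeal A

/-- The canonical homomorphism `π_A : 𝓜(A) → 𝓠(A)`. -/
noncomputable abbrev coronaMap : 𝓜(ℂ, A) →ₐ[ℂ] Corona A :=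
  Ideal.Quotient.mkₐ ℂ (multiplierIdeal A)

/-- The corona algebra carries the quotient matrix norms. -/
noncomputable instance coronaMatrixNorms : MatrixNorms (Corona A) where
  mnorm n q := sInf {r : ℝ | ∃ x : Matrix (Fin n) (Fin n) 𝓜(ℂ, A),
    x.map (coronaMap A) = q ∧ mnorm n x = r}

end Multiplier

/-! ### Extensions -/

/-- An extension `0 → A → B → C → 0` of `C` by `A`. -/
structure Extension (C A : Type u) [OperatorAlgebra C] [OperatorAlgebra A] where
  B : Type u
  [instB : OperatorAlgebra B]
  α : A →ₙₐ[ℂ] B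
  β : B →ₙₐ[ℂ] C
  isometric : CompletelyIsometric α
  exact : ∀ b : B, β b = 0 ↔ ∃ a : A, α a = b
  quotient : IsCompleteQuotientMap β

attribute [instance] Extension.instB

/-! Elementary facts about matrix norms. -/

theorem matrixOp_mul {H : Type u} [NormedAddCommGroup H] [InnerProductSpace ℂ H] {n : ℕ}
    (S T : Matrix (Fin n) (Fin n) (H →L[ℂ] H)) :
    matrixOp (S * T) = matrixOp S ∘L matrixOp T := by
  ext ξ i
  simp only [matrixOp, ContinuousLinearMap.comp_apply, Matrix.mul_apply]
  simp
  rw [Finset.sum_comm]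

theorem mnorm_mul_le {A : Type u} [OperatorAlgebra A] {n : ℕ} (x y : Matrix (Fin n) (Fin n) A) :
    mnorm n (x * y) ≤ mnorm n x * mnorm n y := by
  obtain ⟨H, _, _, _, π, hπ⟩ := OperatorAlgebra.exists_rep (A := A)
  have h : (x * y).map π = x.map π * y.map π := by
    ext1 i j
    simp [Matrix.mul_apply, map_sum]
  rw [hπ, hπ, hπ, h, matrixOp_mul]
  exact ContinuousLinearMap.opNorm_comp_le _ _

theorem mnorm_nonneg {A : Type u} [OperatorAlgebra A] {n : ℕ} (x : Matrix (Fin n) (Fin n) A) :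
    0 ≤ mnorm n x := by
  obtain ⟨H, _, _, _, π, hπ⟩ := OperatorAlgebra.exists_rep (A := A)
  rw [hπ]
  exact norm_nonneg _

namespace Extension

variable {C A : Type u} [OperatorAlgebra C] [OperatorAlgebra A]

theorem norm_α (E : Extension C A) (a : A) : ‖E.α a‖ = ‖a‖ := by
  rw [← OperatorAlgebra.mnorm_one, ← OperatorAlgebra.mnorm_one, ← E.isometric]
  rfl

theorem α_injective (E : Extension C A) : Function.Injective E.α := by
  intro a b h
  rw [← sub_eq_zero, ← norm_eq_zero, ← E.norm_α, map_sub, h, sub_self, norm_zero]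

theorem exists_left (E : Extension C A) (b : E.B) (a : A) : ∃ a' : A, E.α a' = b * E.α a := by
  rw [← E.exact, map_mul, (E.exact _).2 ⟨a, rfl⟩, mul_zero]

theorem exists_right (E : Extension C A) (b : E.B) (a : A) : ∃ a' : A, E.α a' = E.α a * b := by
  rw [← E.exact, map_mul, (E.exact _).2 ⟨a, rfl⟩, zero_mul]

/-- `α⁻¹(b α(a))` -/
noncomputable def leftFun (E : Extension C A) (b : E.B) (a : A) : A :=
  (E.exists_left b a).choose

theorem α_leftFun (E : Extension C A) (b : E.B) (a : A) : E.α (E.leftFun b a) = b * E.α a :=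
  (E.exists_left b a).choose_spec

/-- `α⁻¹(α(a) b)` -/
noncomputable def rightFun (E : Extension C A) (b : E.B) (a : A) : A :=
  (E.exists_right b a).choose

theorem α_rightFun (E : Extension C A) (b : E.B) (a : A) : E.α (E.rightFun b a) = E.α a * b :=
  (E.exists_right b a).choose_spec

/-- `a ↦ α⁻¹(b α(a))` -/
noncomputable def left (E : Extension C A) (b : E.B) : A →L[ℂ] A :=
  LinearMap.mkContinuous
    { toFun := E.leftFun b
      map_add' := fun x y => E.α_injective <| by simp only [map_add, α_leftFun, mul_add]
      map_smul' := fun c x => E.α_injective <| by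
        simp only [map_smul, α_leftFun, mul_smul_comm, RingHom.id_apply] } ‖b‖ fun a => by
    rw [← E.norm_α, ← E.norm_α a]
    exact (congrArg norm (E.α_leftFun b a)).trans_le (norm_mul_le _ _)

/-- `a ↦ α⁻¹(α(a) b)` -/
noncomputable def right (E : Extension C A) (b : E.B) : A →L[ℂ] A :=
  LinearMap.mkContinuous
    { toFun := E.rightFun b
      map_add' := fun x y => E.α_injective <| by simp only [map_add, α_rightFun, add_mul]
      map_smul' := fun c x => E.α_injective <| by
        simp only [map_smul, α_rightFun, smul_mul_assoc, RingHom.id_apply] } ‖b‖ fun a => by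
    rw [← E.norm_α, ← E.norm_α a, mul_comm]
    exact (congrArg norm (E.α_rightFun b a)).trans_le (norm_mul_le _ _)

theorem α_left (E : Extension C A) (b : E.B) (a : A) : E.α (E.left b a) = b * E.α a :=
  E.α_leftFun b a

theorem α_right (E : Extension C A) (b : E.B) (a : A) : E.α (E.right b a) = E.α a * b :=
  E.α_rightFun b a

/-- The canonical homomorphism `σ : B → 𝓜(A)`. -/
noncomputable def σ (E : Extension C A) : E.B →ₙₐ[ℂ] 𝓜(ℂ, A) where
  toFun b :=
    { fst := E.left b
      snd := E.right b
      central := fun x y => E.α_injective <| by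
        rw [map_mul, map_mul, E.α_left, E.α_right, mul_assoc] }
  map_smul' c b := by
    ext a <;> apply E.α_injective <;>
      simp [α_left, α_right, smul_mul_assoc, mul_smul_comm]
  map_zero' := by
    ext a <;> apply E.α_injective <;> simp [α_left, α_right]
  map_add' b b' := by
    ext a <;> apply E.α_injective <;> simp [α_left, α_right, add_mul, mul_add]
  map_mul' b b' := by
    ext a <;> apply E.α_injective <;> simp [α_left, α_right, mul_assoc]

theorem σ_contractive (E : Extension C A) : CompletelyContractive E.σ := by
  intro n x
  refine csInf_le ⟨0, fun K hK => hK.1⟩ ⟨mnorm_nonneg x, fun a => ?_⟩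
  rw [← E.isometric n a, ← E.isometric]
  refine le_of_eq_of_le (congrArg _ ?_) (mnorm_mul_le x (a.map E.α))
  ext i j
  simp only [Matrix.map_apply, Matrix.of_apply, map_sum, Matrix.mul_apply]
  exact Finset.sum_congr rfl fun k _ => E.α_left _ _

theorem β_surjective (E : Extension C A) : Function.Surjective E.β := by
  intro c
  obtain ⟨x, hx, -⟩ := E.quotient.2 1 (Matrix.of fun _ _ => c) _ (lt_add_one _)
  exact ⟨x 0 0, congrFun (congrFun hx 0) 0⟩

theorem multiplier_mnorm_nonneg {n : ℕ} (x : Matrix (Fin n) (Fin n) 𝓜(ℂ, A)) : 0 ≤ mnorm n x :=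
  Real.sInf_nonneg fun _ hK => hK.1

variable [ApproximatelyUnital A]

theorem coronaMap_σ_congr (E : Extension C A) {b b' : E.B} (h : E.β b = E.β b') :
    coronaMap A (E.σ b) = coronaMap A (E.σ b') := by
  obtain ⟨a, ha⟩ := (E.exact (b - b')).1 (by rw [map_sub, h, sub_self])
  refine Ideal.Quotient.eq.2 ⟨a, ?_⟩
  rw [← map_sub, ← ha]
  ext x <;> apply E.α_injective <;> simp [σ, α_left, α_right]

/-- The map `c ↦ σ(b) + A`, where `β(b) = c`. -/
noncomputable def busbyHom (E : Extension C A) : C →ₙₐ[ℂ] Corona A where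
  toFun c := coronaMap A (E.σ (E.β_surjective c).choose)
  map_smul' z c := by
    rw [MonoidHom.id_apply, ← map_smul, ← map_smul]
    exact E.coronaMap_σ_congr (by
      rw [map_smul, (E.β_surjective _).choose_spec, (E.β_surjective _).choose_spec])
  map_zero' := by
    rw [← map_zero (coronaMap A), ← map_zero E.σ]
    exact E.coronaMap_σ_congr (by rw [map_zero, (E.β_surjective _).choose_spec])
  map_add' c d := by
    rw [← map_add, ← map_add]
    exact E.coronaMap_σ_congr (by
      rw [map_add, (E.β_surjective _).choose_spec, (E.β_surjective _).choose_spec,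
        (E.β_surjective _).choose_spec])
  map_mul' c d := by
    rw [← map_mul, ← map_mul]
    exact E.coronaMap_σ_congr (by
      rw [map_mul, (E.β_surjective _).choose_spec, (E.β_surjective _).choose_spec,
        (E.β_surjective _).choose_spec])

theorem busbyHom_β (E : Extension C A) (b : E.B) : E.busbyHom (E.β b) = coronaMap A (E.σ b) :=
  E.coronaMap_σ_congr (E.β_surjective _).choose_spec

/-- The Busby invariant of an extension. -/
noncomputable def busby (E : Extension C A) : Mor C (Corona A) :=
  ⟨E.busbyHom, fun n y => by
    refine le_of_forall_gt_imp_ge_of_dense fun r hr => ?_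
    obtain ⟨x, rfl, hx⟩ := E.quotient.2 n y r hr
    refine le_trans (csInf_le ⟨0, ?_⟩ ⟨x.map E.σ, ?_, rfl⟩) ((E.σ_contractive n x).trans hx.le)
    · rintro _ ⟨m, -, rfl⟩
      exact multiplier_mnorm_nonneg m
    · ext i j
      exact (E.busbyHom_β _).symm⟩


/-- Strong isomorphism of extensions. -/
def StronglyIsomorphic (E₁ E₂ : Extension C A) : Prop :=
  ∃ ρ : E₁.B →ₙₐ[ℂ] E₂.B, CompletelyIsometric ρ ∧ Function.Surjective ρ ∧
    (∀ a, ρ (E₁.α a) = E₂.α a) ∧ ∀ b, E₂.β (ρ b) = E₁.β b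

/-- The extension splits: there is a morphism `γ : C → B` with `β ∘ γ = id`. -/
def IsSplit (E : Extension C A) : Prop :=
  ∃ γ : Mor C E.B, ∀ c, E.β (γ.1 c) = c

end Extension

/-- Strong isomorphism as an equivalence relation. -/
def extensionSetoid (C A : Type u) [OperatorAlgebra C] [OperatorAlgebra A] :
    Setoid (Extension C A) where
  r := Extension.StronglyIsomorphic
  iseqv := by
    refine ⟨fun E => ?_, fun {E₁ E₂} h => ?_, fun {E₁ E₂ E₃} h h' => ?_⟩
    · exact ⟨NonUnitalAlgHom.id ℂ E.B, fun n x => rfl, fun b => ⟨b, rfl⟩, fun _ => rfl, fun _ => rfl⟩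
    · obtain ⟨ρ, hi, hs, hα, hβ⟩ := h
      have hinj : Function.Injective ρ := by
        intro a b h
        rw [← sub_eq_zero, ← norm_eq_zero, ← OperatorAlgebra.mnorm_one, ← hi,
          ← norm_zero (E := E₂.B), ← OperatorAlgebra.mnorm_one]
        congr 1
        ext i j
        simp [h]
      obtain ⟨g, hg, hg'⟩ := Function.bijective_iff_has_inverse.1 ⟨hinj, hs⟩
      refine ⟨{ toFun := g, map_smul' := ?_, map_zero' := ?_, map_add' := ?_, map_mul' := ?_ },
        fun n x => ?_, hg.surjective, fun a => ?_, fun b => ?_⟩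
      · intro c x
        apply hinj
        simp [hg' _]
      · apply hinj
        simp [hg' _]
      · intro x y
        apply hinj
        simp [hg' _]
      · intro x y
        apply hinj
        simp [hg' _]
      · rw [← hi]
        congr 1
        ext i j
        exact hg' _
      · exact hinj ((hg' _).trans (hα a).symm)
      · exact (hβ _).symm.trans (congrArg E₂.β (hg' b))
    · obtain ⟨ρ, hi, hs, hα, hβ⟩ := h
      obtain ⟨ρ', hi', hs', hα', hβ'⟩ := h'
      refine ⟨ρ'.comp ρ, fun n x => ?_, hs'.comp hs, fun a => ?_, fun b => ?_⟩
      · exact (hi' n (x.map ρ)).trans (hi n x)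
      · exact (congrArg ρ' (hα a)).trans (hα' a)
      · exact (hβ' _).trans (hβ b)

/-- `Ext(C, A)`: the strong isomorphism classes of extensions of `C` by `A`. -/
def ExtClasses (C A : Type u) [OperatorAlgebra C] [OperatorAlgebra A] : Type (u + 1) :=
  Quotient (extensionSetoid C A)

section Busby

variable {C A : Type u} [OperatorAlgebra C] [OperatorAlgebra A]

/-- The class of an extension. -/
def Extension.toClass (E : Extension C A) : ExtClasses C A :=
  Quotient.mk (extensionSetoid C A) E

variable [ApproximatelyUnital A]

/-- The Busby invariant of a strong isomorphism class. -/
noncomputable def ExtClasses.busby : ExtClasses C A → Mor C (Corona A) :=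
  Quotient.lift Extension.busby <| by
    rintro E₁ E₂ ⟨ρ, -, -, hα, hβ⟩
    refine Subtype.ext (NonUnitalAlgHom.ext fun c => ?_)
    obtain ⟨b, rfl⟩ := E₁.β_surjective c
    have h : E₁.σ b = E₂.σ (ρ b) := by
      ext a <;> apply E₂.α_injective
      · exact (hα _).symm.trans ((congrArg ρ (E₁.α_left b a)).trans
          ((map_mul ρ _ _).trans ((congrArg (ρ b * ·) (hα a)).trans (E₂.α_left _ a).symm)))
      · exact (hα _).symm.trans ((congrArg ρ (E₁.α_right b a)).trans
          ((map_mul ρ _ _).trans ((congrArg (· * ρ b) (hα a)).trans (E₂.α_right _ a).symm)))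
    calc E₁.busbyHom (E₁.β b) = coronaMap A (E₂.σ (ρ b)) := by rw [E₁.busbyHom_β, h]
      _ = E₂.busbyHom (E₁.β b) := by rw [← E₂.busbyHom_β, hβ]

/-- The pullback `PB = 𝓜(A) ⊕_{𝓠(A)} C` of `π_A` and `τ : C → 𝓠(A)`. -/
noncomputable def coronaPullback (τ : Mor C (Corona A)) : NonUnitalSubalgebra ℂ (𝓜(ℂ, A) × C) where
  carrier := {p | coronaMap A p.1 = τ.1 p.2}
  add_mem' {p q} hp hq := by
    simp only [Set.mem_ofPred_eq, Prod.fst_add, Prod.snd_add, map_add] at *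
    rw [hp, hq]
  zero_mem' := by simp only [Set.mem_ofPred_eq, Prod.fst_zero, Prod.snd_zero, map_zero]
  mul_mem' {p q} hp hq := by
    simp only [Set.mem_ofPred_eq, Prod.fst_mul, Prod.snd_mul, map_mul] at *
    rw [hp, hq]
  smul_mem' c p hp := by
    simp only [Set.mem_ofPred_eq, Prod.smul_fst, Prod.smul_snd, map_smul] at *
    rw [hp]

/-- The matrix norms which `PB` inherits from `𝓜(A) ⊕^∞ C`. -/
noncomputable instance pullbackMatrixNorms (τ : Mor C (Corona A)) : MatrixNorms (coronaPullback τ) where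
  mnorm n x := max (mnorm n (x.map fun p => p.1.1)) (mnorm n (x.map fun p => p.1.2))

/-- `E` is strongly isomorphic to the pullback extension `0 → A → PB → C → 0` constructed from `τ`,
whose maps are `a ↦ (a, 0)` and `(m, c) ↦ c`. -/
def Extension.IsPullback (E : Extension C A) (τ : Mor C (Corona A)) : Prop :=
  ∃ φ : E.B →ₙₐ[ℂ] coronaPullback τ, CompletelyIsometric φ ∧ Function.Surjective φ ∧
    (∀ a : A, (φ (E.α a)).1 = ((a : 𝓜(ℂ, A)), (0 : C))) ∧ ∀ b, (φ b).1.2 = E.β b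

end Busby

/-! An extension algebra `B` is recovered from its Busby invariant because `b ↦ (σ b, β b)` is a
completely isometric isomorphism of `B` onto the pullback. Algebraically this is a diagram chase;
the substance is the norm identity `Extension.mnorm_eq_max`.

To prove it, represent `B` completely isometrically on `H` and let `K` be the subspace on which the
contractive approximate identity of `A` converges strongly to the identity. Contractivity forces `A`
to vanish on `Kᗮ`, and since `A` is an ideal, both `K` and `Kᗮ` are invariant under `B`. On `K` an
element `b` is the strong limit of the products `b e`, so its norm is controlled by `σ b`; on `Kᗮ`
the representation factors through `B / A = C`, so its norm is controlled by `β b`.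

Conversely, every `τ` must yield an operator algebra. A representation of `A` extends to `𝓜(A)` by
strong limits and computes its matrix norms. Its direct sum with a representation of `C` then
represents the pullback, which is closed because `A` is closed in `𝓜(A)`. The canonical map `σ` of
the pullback is the first projection, so its Busby invariant is `τ`. The statements on split and
unital extensions are read off in this model. -/

open Filter Topology

/-! ### Norms of operator matrices -/

section MatrixOp

variable {H : Type u} [NormedAddCommGroup H] [InnerProductSpace ℂ H] {n : ℕ}

theorem matrixOp_apply (T : Matrix (Fin n) (Fin n) (H →L[ℂ] H)) (ξ : PiLp 2 (fun _ : Fin n => H))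
    (i : Fin n) : matrixOp T ξ i = ∑ j, T i j (ξ j) := by
  simp [matrixOp]

theorem norm_matrixOp_of_const (T : H →L[ℂ] H) :
    ‖matrixOp (Matrix.of fun _ _ : Fin 1 => T)‖ = ‖T‖ := by
  have norm_one (ξ : PiLp 2 (fun _ : Fin 1 => H)) : ‖ξ‖ = ‖ξ 0‖ := by
    simp [PiLp.norm_eq_of_L2]
  refine le_antisymm (ContinuousLinearMap.opNorm_le_bound _ (norm_nonneg T) fun ξ => ?_)
    (ContinuousLinearMap.opNorm_le_bound _
      (norm_nonneg (matrixOp (Matrix.of fun _ _ : Fin 1 => T))) fun ξ => ?_)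
  · rw [norm_one, norm_one, matrixOp_apply]
    simpa using T.le_opNorm (ξ 0)
  · have h := (matrixOp (Matrix.of fun _ _ : Fin 1 => T)).le_opNorm (WithLp.toLp 2 fun _ => ξ)
    rw [norm_one, norm_one, matrixOp_apply] at h
    simpa using h

/-- If a closed subspace reduces all entries of a matrix of operators, then the norm of the matrix
is determined on vectors with entries in the subspace and on vectors with entries in its orthogonal
complement. -/
theorem norm_matrixOp_le_of_reducing (K : Submodule ℂ H) [K.HasOrthogonalProjection]
    (T : Matrix (Fin n) (Fin n) (H →L[ℂ] H)) {M : ℝ} (hM : 0 ≤ M)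
    (hK : ∀ i j, ∀ ξ ∈ K, T i j ξ ∈ K) (hK' : ∀ i j, ∀ ξ ∈ Kᗮ, T i j ξ ∈ Kᗮ)
    (h : ∀ ξ : PiLp 2 (fun _ : Fin n => H), (∀ i, ξ i ∈ K) → ‖matrixOp T ξ‖ ≤ M * ‖ξ‖)
    (h' : ∀ ξ : PiLp 2 (fun _ : Fin n => H), (∀ i, ξ i ∈ Kᗮ) → ‖matrixOp T ξ‖ ≤ M * ‖ξ‖) :
    ‖matrixOp T‖ ≤ M := by
  have norm_add {ξ η : PiLp 2 (fun _ : Fin n => H)} (hξ : ∀ i, ξ i ∈ K) (hη : ∀ i, η i ∈ Kᗮ) :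
      ‖ξ + η‖ ^ 2 = ‖ξ‖ ^ 2 + ‖η‖ ^ 2 := by
    rw [PiLp.norm_sq_eq_of_L2, PiLp.norm_sq_eq_of_L2, PiLp.norm_sq_eq_of_L2,
      ← Finset.sum_add_distrib]
    refine Finset.sum_congr rfl fun i _ => ?_
    simp only [PiLp.add_apply, sq]
    exact norm_add_sq_eq_norm_sq_add_norm_sq_of_inner_eq_zero _ _
      (Submodule.inner_right_of_mem_orthogonal (hξ i) (hη i))
  refine ContinuousLinearMap.opNorm_le_bound _ hM fun ζ => ?_
  obtain ⟨ξ, η, hξ, hη, rfl⟩ : ∃ ξ η : PiLp 2 (fun _ : Fin n => H),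
      (∀ i, ξ i ∈ K) ∧ (∀ i, η i ∈ Kᗮ) ∧ ξ + η = ζ := by
    refine ⟨WithLp.toLp 2 fun i => K.starProjection (ζ i),
      WithLp.toLp 2 fun i => Kᗮ.starProjection (ζ i),
      fun i => K.starProjection_apply_mem _, fun i => Kᗮ.starProjection_apply_mem _, ?_⟩
    ext i
    exact K.starProjection_add_starProjection_orthogonal (ζ i)
  have hTξ : ∀ i, matrixOp T ξ i ∈ K := fun i => by
    rw [matrixOp_apply]
    exact K.sum_mem fun j _ => hK i j _ (hξ j)
  have hTη : ∀ i, matrixOp T η i ∈ Kᗮ := fun i => by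
    rw [matrixOp_apply]
    exact Kᗮ.sum_mem fun j _ => hK' i j _ (hη j)
  refine le_of_sq_le_sq ?_ (by positivity)
  rw [map_add, norm_add hTξ hTη, mul_pow, norm_add hξ hη, mul_add, ← mul_pow, ← mul_pow]
  gcongr
  exacts [h ξ hξ, h' η hη]

/-- Convergence is required only at the entries of the single vector `ξ`, because approximate
identities are later known to converge only on a subspace. -/
theorem norm_matrixOp_apply_le_of_tendsto {ι : Type*} {l : Filter ι} [l.NeBot]
    {S : ι → Matrix (Fin n) (Fin n) (H →L[ℂ] H)} {T : Matrix (Fin n) (Fin n) (H →L[ℂ] H)}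
    {ξ : PiLp 2 (fun _ : Fin n => H)} {M : ℝ}
    (h : ∀ i j, Tendsto (fun e => S e i j (ξ j)) l (𝓝 (T i j (ξ j))))
    (hS : ∀ᶠ e in l, ‖matrixOp (S e)‖ ≤ M) : ‖matrixOp T ξ‖ ≤ M * ‖ξ‖ := by
  have ht : Tendsto (fun e => matrixOp (S e) ξ) l (𝓝 (matrixOp T ξ)) := by
    refine (PiLp.homeomorph 2 (fun _ : Fin n => H)).isInducing.tendsto_nhds_iff.2 <|
      tendsto_pi_nhds.2 fun i => ?_
    change Tendsto (fun e => matrixOp (S e) ξ i) l (𝓝 (matrixOp T ξ i))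
    simp only [matrixOp_apply]
    exact tendsto_finsetSum _ fun j _ => h i j
  refine le_of_tendsto ht.norm (hS.mono fun e he => ?_)
  exact ((matrixOp (S e)).le_opNorm ξ).trans (by gcongr)

theorem norm_matrixOp_diagonal_le (T : H →L[ℂ] H) :
    ‖matrixOp (Matrix.diagonal fun _ : Fin n => T)‖ ≤ ‖T‖ := by
  refine ContinuousLinearMap.opNorm_le_bound _ (norm_nonneg T) fun ξ => ?_
  refine le_of_sq_le_sq ?_ (by positivity)
  rw [mul_pow, PiLp.norm_sq_eq_of_L2, PiLp.norm_sq_eq_of_L2, Finset.mul_sum]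
  refine Finset.sum_le_sum fun i _ => ?_
  have : matrixOp (Matrix.diagonal fun _ : Fin n => T) ξ i = T (ξ i) := by
    rw [matrixOp_apply, Finset.sum_eq_single i] <;>
      simp +contextual [eq_comm]
  rw [this, ← mul_pow]
  exact pow_le_pow_left₀ (norm_nonneg _) (T.le_opNorm _) 2

end MatrixOp

/-! ### The essential subspace of a contractive representation -/

section EssentialSubspace

variable {A H : Type u} [OperatorAlgebra A] [NormedAddCommGroup H] [InnerProductSpace ℂ H]
  (ρ : A →ₙₐ[ℂ] (H →L[ℂ] H)) (l : Filter A)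

/-- The vectors on which a net of operators converges to the identity. -/
def essentialSubspace : Submodule ℂ H where
  carrier := {ξ | Tendsto (fun e => ρ e ξ) l (𝓝 ξ)}
  add_mem' {ξ η} hξ hη := by
    simpa only [Set.mem_ofPred_eq, map_add] using Tendsto.add hξ hη
  zero_mem' := by simpa only [Set.mem_ofPred_eq, map_zero] using tendsto_const_nhds
  smul_mem' c ξ hξ := by
    simpa only [Set.mem_ofPred_eq, map_smul] using Tendsto.const_smul hξ c

variable {ρ l}

theorem mem_essentialSubspace {ξ : H} :
    ξ ∈ essentialSubspace ρ l ↔ Tendsto (fun e => ρ e ξ) l (𝓝 ξ) := Iff.rfl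

theorem isClosed_essentialSubspace (hρ : ∀ a, ‖ρ a‖ ≤ ‖a‖) (hl : ∀ᶠ e in l, ‖e‖ ≤ 1) :
    IsClosed (essentialSubspace ρ l : Set H) := by
  refine isClosed_of_closure_subset fun ξ hξ => ?_
  refine Metric.tendsto_nhds.2 fun ε hε => ?_
  obtain ⟨η, hη, hd⟩ := Metric.mem_closure_iff.1 hξ (ε / 3) (by positivity)
  filter_upwards [hl, Metric.tendsto_nhds.1 (mem_essentialSubspace.1 hη) (ε / 3) (by positivity)]
    with e he he'
  have h1 : dist (ρ e ξ) (ρ e η) ≤ dist ξ η := by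
    rw [dist_eq_norm, dist_eq_norm, ← map_sub]
    exact ((ρ e).le_opNorm _).trans
      (mul_le_of_le_one_left (norm_nonneg _) ((hρ e).trans he))
  have h2 := dist_triangle4 (ρ e ξ) (ρ e η) η ξ
  rw [dist_comm η ξ] at h2
  linarith

theorem apply_mem_essentialSubspace (hρ : ∀ a, ‖ρ a‖ ≤ ‖a‖) (hl : l.IsApproximateUnit) (a : A)
    (ξ : H) : ρ a ξ ∈ essentialSubspace ρ l := by
  have hc : Continuous fun a => ρ a ξ :=
    ((ContinuousLinearMap.apply ℂ H ξ).continuous).comp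
      (AddMonoidHomClass.continuous_of_bound ρ 1 fun a => by simpa using hρ a)
  refine (hc.tendsto a |>.comp (hl.tendsto_mul_right a)).congr fun e => ?_
  simp

/-- The algebra need not be selfadjoint, so orthogonality to the ranges of the `ρ b` does not by
itself give this. The point is that `(ρ e)* → 1` strongly on the essential subspace, which lets `e`
be moved to the other side of the inner product. -/
theorem apply_eq_zero_of_mem_orthogonal [CompleteSpace H] (hρ : ∀ a, ‖ρ a‖ ≤ ‖a‖)
    (hl : l.IsApproximateUnit) (hl' : ∀ᶠ e in l, ‖e‖ ≤ 1) (a : A) {ζ : H}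
    (hζ : ζ ∈ (essentialSubspace ρ l)ᗮ) : ρ a ζ = 0 := by
  have := hl.neBot
  have : CompleteSpace (essentialSubspace ρ l) :=
    (isClosed_essentialSubspace hρ hl').completeSpace_coe
  -- contractivity makes the adjoints converge on the essential subspace as well
  have adj {v : H} (hv : v ∈ essentialSubspace ρ l) :
      Tendsto (fun e => (ρ e).adjoint v) l (𝓝 v) := by
    rw [tendsto_iff_norm_sub_tendsto_zero]
    -- This expression bounds `‖(ρ e)* v - v‖²`: expand the square and use `‖(ρ e)* v‖ ≤ ‖v‖`.
    have h0 : Tendsto (fun e => 2 * ‖v‖ ^ 2 - 2 * RCLike.re (inner ℂ v (ρ e v))) l (𝓝 0) := by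
      have h1 : Tendsto (fun e => RCLike.re (inner ℂ v (ρ e v))) l (𝓝 (‖v‖ ^ 2)) := by
        rw [← inner_self_eq_norm_sq (𝕜 := ℂ) v]
        exact (RCLike.continuous_re.tendsto _).comp (tendsto_const_nhds.inner hv)
      exact ((h1.const_mul 2).const_sub (2 * ‖v‖ ^ 2)).trans_eq (congrArg 𝓝 (sub_self _))
    have h2 : Tendsto (fun e => ‖(ρ e).adjoint v - v‖ ^ 2) l (𝓝 0) := by
      refine tendsto_of_tendsto_of_tendsto_of_le_of_le' tendsto_const_nhds h0
        (Eventually.of_forall fun e => by positivity) ?_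
      filter_upwards [hl'] with e he
      have h3 : ‖(ρ e).adjoint v‖ ≤ ‖v‖ := by
        refine ((ρ e).adjoint.le_opNorm v).trans (mul_le_of_le_one_left (norm_nonneg _) ?_)
        rw [LinearIsometryEquiv.norm_map]
        exact (hρ e).trans he
      rw [norm_sub_sq (𝕜 := ℂ), ContinuousLinearMap.adjoint_inner_left]
      have := pow_le_pow_left₀ (norm_nonneg _) h3 2
      linarith
    simpa using h2.sqrt
  have hmem (b : A) (ξ : H) := apply_mem_essentialSubspace hρ hl b ξ
  refine ext_inner_left ℂ fun η => ?_
  obtain ⟨v, hv, w, hw, hvw⟩ := (essentialSubspace ρ l).exists_add_mem_mem_orthogonal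
    ((ρ a).adjoint η)
  have h1 : Tendsto (fun e => inner ℂ η (ρ (a * e) ζ)) l (𝓝 (inner ℂ η (ρ a ζ))) := by
    have hc : Continuous fun a => ρ a ζ :=
      ((ContinuousLinearMap.apply ℂ H ζ).continuous).comp
        (AddMonoidHomClass.continuous_of_bound ρ 1 fun a => by simpa using hρ a)
    exact tendsto_const_nhds.inner (hc.tendsto a |>.comp (hl.tendsto_mul_left a))
  -- Since `ρ e ζ` is in the essential subspace, only the component `v` of `(ρ a)* η` contributes,
  -- giving `⟪(ρ e)* v, ζ⟫`.
  have h2 : Tendsto (fun e => inner ℂ η (ρ (a * e) ζ)) l (𝓝 (inner ℂ v ζ)) := by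
    refine ((adj hv).inner tendsto_const_nhds).congr fun e => ?_
    rw [map_mul, ContinuousLinearMap.adjoint_inner_left, mul_apply_eq_comp,
      ← ContinuousLinearMap.adjoint_inner_left (ρ a), hvw, inner_add_left,
      Submodule.inner_left_of_mem_orthogonal (hmem e ζ) hw, add_zero]
  rw [tendsto_nhds_unique h1 h2, Submodule.inner_right_of_mem_orthogonal hv hζ, inner_zero_right]

end EssentialSubspace

theorem mnorm_zero_right {A : Type u} [OperatorAlgebra A] {n : ℕ} :
    mnorm n (0 : Matrix (Fin n) (Fin n) A) = 0 := by
  obtain ⟨H, _, _, _, π, hπ⟩ := OperatorAlgebra.exists_rep (A := A)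
  rw [hπ, norm_eq_zero]
  ext ξ i
  simp [matrixOp_apply]

theorem mnorm_diagonal_le {A : Type u} [OperatorAlgebra A] {n : ℕ} (a : A) :
    mnorm n (Matrix.diagonal fun _ => a) ≤ ‖a‖ := by
  obtain ⟨H, _, _, _, π, hπ⟩ := OperatorAlgebra.exists_rep (A := A)
  rw [hπ, ← OperatorAlgebra.mnorm_one, hπ, Matrix.diagonal_map (map_zero π)]
  exact (norm_matrixOp_diagonal_le (π a)).trans_eq (norm_matrixOp_of_const (π a)).symm

/-! ### Module identities for double centralizers -/

namespace DoubleCentralizer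

variable {A : Type u} [OperatorAlgebra A] [ApproximatelyUnital A]

theorem fst_mul_apply (m : 𝓜(ℂ, A)) (a b : A) : m.fst (a * b) = m.fst a * b :=
  eq_of_forall_mul_left fun x => by
    rw [← m.central, ← mul_assoc, ← mul_assoc, m.central]

theorem snd_mul_apply (m : 𝓜(ℂ, A)) (a b : A) : m.snd (a * b) = a * m.snd b :=
  eq_of_forall_mul_right fun x => by
    rw [m.central, mul_assoc, mul_assoc, m.central]

theorem coe_injective : Function.Injective (fun a : A => (a : 𝓜(ℂ, A))) := by
  intro a b h
  refine eq_of_forall_mul_right fun x => ?_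
  simpa using congrArg (fun m : 𝓜(ℂ, A) => m.fst x) h

end DoubleCentralizer

/-! ### Extending a representation to the multiplier algebra -/

section MultiplierRep

variable {A H : Type u} [OperatorAlgebra A] [NormedAddCommGroup H] [InnerProductSpace ℂ H]

theorem norm_rep_apply {π : A →ₙₐ[ℂ] (H →L[ℂ] H)}
    (hπ : ∀ (n : ℕ) (x : Matrix (Fin n) (Fin n) A), mnorm n x = ‖matrixOp (x.map π)‖) (a : A) :
    ‖π a‖ = ‖a‖ := by
  rw [← OperatorAlgebra.mnorm_one, hπ]
  exact (norm_matrixOp_of_const (π a)).symm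

variable {π : A →ₙₐ[ℂ] (H →L[ℂ] H)} {l : Filter A}

/-- The orthogonal complement of the essential subspace is annihilated, so only its component in the
subspace matters; there the net is Cauchy because the operators `π (m e)` are eventually bounded by
`‖m.fst‖`. -/
theorem exists_tendsto_fst [CompleteSpace H] [ApproximatelyUnital A]
    (hπ : ∀ a, ‖π a‖ ≤ ‖a‖) (hl : l.IsApproximateUnit)
    (hl' : ∀ᶠ e in l, ‖e‖ ≤ 1) (m : 𝓜(ℂ, A)) (ξ : H) :
    ∃ v : H, Tendsto (fun e => π (m.fst e) ξ) l (𝓝 v) := by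
  have := hl.neBot
  have : CompleteSpace (essentialSubspace π l) :=
    (isClosed_essentialSubspace hπ hl').completeSpace_coe
  obtain ⟨ξ, hξ, ζ, hζ, rfl⟩ := (essentialSubspace π l).exists_add_mem_mem_orthogonal ξ
  simp only [map_add, apply_eq_zero_of_mem_orthogonal hπ hl hl' _ hζ, add_zero]
  refine cauchy_map_iff_exists_tendsto.1 ?_
  have hc : Continuous π := AddMonoidHomClass.continuous_of_bound π 1 fun a => by simpa using hπ a
  refine Metric.cauchy_iff.2 ⟨inferInstance, fun ε hε => ?_⟩
  -- on the range of `π a` the limit exists, and such vectors approximate `ξ`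
  obtain ⟨a, ha⟩ := ((tendsto_iff_norm_sub_tendsto_zero.1 hξ).eventually_lt_const
    -- Replacing `ξ` by `π a ξ` then costs at most `ε / 4`, uniformly in contractive `e`; the `+ 1`
    -- covers `m.fst = 0`.
    (show 0 < ε / (4 * (‖m.fst‖ + 1)) by positivity)).exists
  have hlim : Tendsto (fun e => π (m.fst e) (π a ξ)) l (𝓝 (π (m.fst a) ξ)) := by
    have h1 : Tendsto (fun e => π (m.fst (e * a))) l (𝓝 (π (m.fst a))) :=
      ((hc.comp m.fst.continuous).tendsto a).comp (hl.tendsto_mul_right a)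
    refine (((ContinuousLinearMap.apply ℂ H ξ).continuous.tendsto _).comp h1).congr fun e => ?_
    simp [DoubleCentralizer.fst_mul_apply]
  have key : ∀ᶠ e in l, dist (π (m.fst e) ξ) (π (m.fst a) ξ) < ε / 2 := by
    filter_upwards [hl', Metric.tendsto_nhds.1 hlim (ε / 4) (by positivity)] with e he he'
    have h1 : dist (π (m.fst e) ξ) (π (m.fst e) (π a ξ)) ≤ ε / 4 := by
      rw [dist_eq_norm, ← map_sub]
      calc ‖π (m.fst e) (ξ - π a ξ)‖ ≤ ‖π (m.fst e)‖ * ‖ξ - π a ξ‖ :=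
            (π (m.fst e)).le_opNorm _
        _ ≤ (‖m.fst‖ + 1) * (ε / (4 * (‖m.fst‖ + 1))) := by
            gcongr
            · refine (hπ _).trans ((m.fst.le_opNorm e).trans ?_)
              nlinarith [norm_nonneg m.fst]
            · rw [norm_sub_rev]; exact ha.le
        _ = ε / 4 := by field_simp
    linarith [dist_triangle (π (m.fst e) ξ) (π (m.fst e) (π a ξ)) (π (m.fst a) ξ)]
  refine ⟨_, image_mem_map key, ?_⟩
  rintro _ ⟨e, he, rfl⟩ _ ⟨e', he', rfl⟩
  rw [Set.mem_ofPred_eq] at he he'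
  linarith [dist_triangle_right (π (m.fst e) ξ) (π (m.fst e') ξ) (π (m.fst a) ξ)]

/-- Stated for an arbitrary strong limit `T`, since it is what proves that the extension to `𝓜(A)`
is multiplicative. -/
theorem mul_rep_of_tendsto [ApproximatelyUnital A]
    (hπ : ∀ a, ‖π a‖ ≤ ‖a‖) (hl : l.IsApproximateUnit) {m : 𝓜(ℂ, A)}
    {T : H →L[ℂ] H} (hT : ∀ ξ, Tendsto (fun e => π (m.fst e) ξ) l (𝓝 (T ξ))) (a : A) :
    T * π a = π (m.fst a) := by
  have := hl.neBot
  have hc : Continuous π := AddMonoidHomClass.continuous_of_bound π 1 fun a => by simpa using hπ a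
  ext ξ
  refine tendsto_nhds_unique (hT _) ?_
  have h1 : Tendsto (fun e => π (m.fst (e * a))) l (𝓝 (π (m.fst a))) :=
    ((hc.comp m.fst.continuous).tendsto a).comp (hl.tendsto_mul_right a)
  refine (((ContinuousLinearMap.apply ℂ H ξ).continuous.tendsto _).comp h1).congr fun e => ?_
  simp [DoubleCentralizer.fst_mul_apply]

/-- A contractive representation of `A` extends to the multiplier algebra; `m` acts as the limit of
the operators `π (m e)`, where `e` runs through an approximate identity. -/
theorem exists_multiplierRep [CompleteSpace H] [ApproximatelyUnital A]
    (hπ : ∀ a, ‖π a‖ ≤ ‖a‖) (hl : l.IsApproximateUnit)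
    (hl' : ∀ᶠ e in l, ‖e‖ ≤ 1) :
    ∃ θ : 𝓜(ℂ, A) →ₙₐ[ℂ] (H →L[ℂ] H),
      (∀ m ξ, Tendsto (fun e => π (m.fst e) ξ) l (𝓝 (θ m ξ))) := by
  have := hl.neBot
  have hc : Continuous π := AddMonoidHomClass.continuous_of_bound π 1 fun a => by simpa using hπ a
  choose F hF using exists_tendsto_fst (π := π) hπ hl hl'
  have hFnorm (m : 𝓜(ℂ, A)) (ξ : H) : ‖F m ξ‖ ≤ ‖m.fst‖ * ‖ξ‖ := by
    refine le_of_tendsto (hF m ξ).norm (hl'.mono fun e he => ?_)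
    refine ((π (m.fst e)).le_opNorm ξ).trans ?_
    gcongr
    refine (hπ _).trans ((m.fst.le_opNorm e).trans ?_)
    exact mul_le_of_le_one_right (norm_nonneg _) he
  let θ (m : 𝓜(ℂ, A)) : H →L[ℂ] H :=
    LinearMap.mkContinuous
      { toFun := F m
        map_add' := fun ξ η => tendsto_nhds_unique (hF m _) <| by
          simpa only [map_add] using (hF m ξ).add (hF m η)
        map_smul' := fun c ξ => tendsto_nhds_unique (hF m _) <| by
          simpa only [map_smul, RingHom.id_apply] using (hF m ξ).const_smul c } ‖m.fst‖ (hFnorm m)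
  have hθ (m : 𝓜(ℂ, A)) (ξ : H) : Tendsto (fun e => π (m.fst e) ξ) l (𝓝 (θ m ξ)) := hF m ξ
  refine ⟨{ toFun := θ, map_smul' := fun c m => ?_, map_zero' := ?_, map_add' := fun m m' => ?_,
            map_mul' := fun m m' => ?_ }, hθ⟩ <;> ext ξ
  · exact tendsto_nhds_unique (hθ _ ξ) (by simpa using (hθ m ξ).const_smul c)
  · exact tendsto_nhds_unique (hθ _ ξ) (by simp)
  · exact tendsto_nhds_unique (hθ _ ξ) (by simpa using (hθ m ξ).add (hθ m' ξ))
  · have h (a : A) : θ m (π a ξ) = π (m.fst a) ξ :=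
      DFunLike.congr_fun (mul_rep_of_tendsto hπ hl (hθ m) a) ξ
    refine tendsto_nhds_unique (hθ _ ξ) ?_
    refine (((θ m).continuous.tendsto _).comp (hθ m' ξ)).congr fun e => ?_
    simp [h]

variable {θ : 𝓜(ℂ, A) →ₙₐ[ℂ] (H →L[ℂ] H)}

theorem rep_mul_multiplierRep (hπ : ∀ a, ‖π a‖ ≤ ‖a‖) (hl : l.IsApproximateUnit)
    (hθ : ∀ m ξ, Tendsto (fun e => π (m.fst e) ξ) l (𝓝 (θ m ξ))) (m : 𝓜(ℂ, A)) (a : A) :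
    π a * θ m = π (m.snd a) := by
  have := hl.neBot
  have hc : Continuous π := AddMonoidHomClass.continuous_of_bound π 1 fun a => by simpa using hπ a
  ext ξ
  refine tendsto_nhds_unique (((π a).continuous.tendsto _).comp (hθ m ξ)) ?_
  have h1 : Tendsto (fun e => π (m.snd a * e)) l (𝓝 (π (m.snd a))) :=
    (hc.tendsto _).comp (hl.tendsto_mul_left _)
  refine (((ContinuousLinearMap.apply ℂ H ξ).continuous.tendsto _).comp h1).congr fun e => ?_
  simp [m.central]

theorem multiplierRep_coe (hπ : ∀ a, ‖π a‖ ≤ ‖a‖) (hl : l.IsApproximateUnit)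
    (hθ : ∀ m ξ, Tendsto (fun e => π (m.fst e) ξ) l (𝓝 (θ m ξ))) (a : A) :
    θ (a : 𝓜(ℂ, A)) = π a := by
  have := hl.neBot
  have hc : Continuous π := AddMonoidHomClass.continuous_of_bound π 1 fun a => by simpa using hπ a
  ext ξ
  refine tendsto_nhds_unique (hθ _ ξ) ?_
  exact ((ContinuousLinearMap.apply ℂ H ξ).continuous.tendsto _).comp
    ((hc.tendsto _).comp (hl.tendsto_mul_left a))

/-- The norm of a double centralizer is the larger of its left and right norms. Both are at most `‖θ
m‖` because `θ m` implements the two multiplications; the reverse bound passes to the limit along `π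
(m e)`. -/
theorem norm_multiplierRep [ApproximatelyUnital A]
    (hπ : ∀ a, ‖π a‖ = ‖a‖) (hl : l.IsApproximateUnit)
    (hl' : ∀ᶠ e in l, ‖e‖ ≤ 1)
    (hθ : ∀ m ξ, Tendsto (fun e => π (m.fst e) ξ) l (𝓝 (θ m ξ))) (m : 𝓜(ℂ, A)) :
    ‖θ m‖ = ‖m‖ := by
  have := hl.neBot
  refine le_antisymm ?_ ?_
  · refine ContinuousLinearMap.opNorm_le_bound _ (norm_nonneg m) fun ξ => ?_
    refine le_of_tendsto (hθ m ξ).norm (hl'.mono fun e he => ?_)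
    refine ((π (m.fst e)).le_opNorm ξ).trans ?_
    gcongr
    refine (hπ _).trans_le ((m.fst.le_opNorm e).trans ?_)
    exact (mul_le_of_le_one_right (norm_nonneg _) he).trans (norm_fst_le m.toProd)
  · refine max_le (ContinuousLinearMap.opNorm_le_bound _ (norm_nonneg (θ m)) fun a => ?_)
      (ContinuousLinearMap.opNorm_le_bound _ (norm_nonneg (θ m)) fun a => ?_)
    · rw [← hπ a]
      exact ((hπ _).symm.trans (congrArg norm
        (mul_rep_of_tendsto (fun a => (hπ a).le) hl (hθ m) a).symm)).trans_le (norm_mul_le _ _)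
    · rw [← hπ a, mul_comm]
      exact ((hπ _).symm.trans (congrArg norm
        (rep_mul_multiplierRep (fun a => (hπ a).le) hl hθ m a).symm)).trans_le (norm_mul_le _ _)

theorem mnorm_multiplier_eq [ApproximatelyUnital A]
    (hπ : ∀ (n : ℕ) (x : Matrix (Fin n) (Fin n) A), mnorm n x = ‖matrixOp (x.map π)‖)
    (hl : l.IsApproximateUnit) (hl' : ∀ᶠ e in l, ‖e‖ ≤ 1)
    (hθ : ∀ m ξ, Tendsto (fun e => π (m.fst e) ξ) l (𝓝 (θ m ξ))) {n : ℕ}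
    (x : Matrix (Fin n) (Fin n) 𝓜(ℂ, A)) : mnorm n x = ‖matrixOp (x.map θ)‖ := by
  have := hl.neBot
  refine IsLeast.csInf_eq ⟨⟨norm_nonneg (matrixOp (x.map θ)), fun a => ?_⟩, fun K hK => ?_⟩
  · have h : (Matrix.of fun i j => ∑ k, (x i k).fst (a k j)).map π = x.map θ * a.map π := by
      ext1 i j
      simp only [Matrix.map_apply, Matrix.of_apply, Matrix.mul_apply, map_sum]
      exact Finset.sum_congr rfl fun k _ =>
        (mul_rep_of_tendsto (fun a => (norm_rep_apply hπ a).le) hl (hθ _) _).symm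
    rw [hπ, hπ, h, matrixOp_mul]
    exact ContinuousLinearMap.opNorm_comp_le _ _
  · refine ContinuousLinearMap.opNorm_le_bound _ hK.1 fun ξ => ?_
    refine norm_matrixOp_apply_le_of_tendsto
      (S := fun e => Matrix.of fun i j => π ((x i j).fst e))
      (fun i j => hθ (x i j) (ξ j)) (hl'.mono fun e he => ?_)
    -- Testing the bound `K` on the contraction `diag(e, …, e)` controls `x · diag(e, …, e)`, whose
    -- strong limit is the matrix of the `θ (x i j)`.
    have h := hK.2 (Matrix.diagonal fun _ => e)
    have h' : (Matrix.of fun i j => ∑ k, (x i k).fst ((Matrix.diagonal fun _ => e) k j)) =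
        Matrix.of fun i j => (x i j).fst e := by
      ext i j
      rw [Matrix.of_apply, Matrix.of_apply, Finset.sum_eq_single j] <;>
        simp +contextual
    rw [h', hπ] at h
    exact h.trans (mul_le_of_le_one_right hK.1 ((mnorm_diagonal_le e).trans he))

end MultiplierRep

/-! ### Matrix norms of the multiplier algebra -/

section Multiplier

variable {A : Type u} [OperatorAlgebra A] [ApproximatelyUnital A]

/-- The multiplier algebra is an operator algebra. -/
theorem exists_rep_multiplier :
    ∃ (H : Type u) (_ : NormedAddCommGroup H) (_ : InnerProductSpace ℂ H)
      (_ : CompleteSpace H) (θ : 𝓜(ℂ, A) →ₙₐ[ℂ] (H →L[ℂ] H)),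
      (∀ m, ‖θ m‖ = ‖m‖) ∧
      (∀ (n : ℕ) (x : Matrix (Fin n) (Fin n) 𝓜(ℂ, A)), mnorm n x = ‖matrixOp (x.map θ)‖) ∧
      ∀ (n : ℕ) (x : Matrix (Fin n) (Fin n) A),
        mnorm n x = ‖matrixOp (x.map fun a => θ (a : 𝓜(ℂ, A)))‖ := by
  obtain ⟨H, _, _, _, π, hπ⟩ := OperatorAlgebra.exists_rep (A := A)
  obtain ⟨l, hl, hl'⟩ := ApproximatelyUnital.exists_cai (A := A)
  have hπ' := norm_rep_apply hπ
  obtain ⟨θ, hθ⟩ := exists_multiplierRep (fun a => (hπ' a).le) hl hl'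
  refine ⟨H, _, _, inferInstance, θ, norm_multiplierRep hπ' hl hl' hθ,
    fun n x => mnorm_multiplier_eq hπ hl hl' hθ x, fun n x => ?_⟩
  simp only [multiplierRep_coe (fun a => (hπ' a).le) hl hθ]
  exact hπ n x

theorem mnorm_coe {n : ℕ} (x : Matrix (Fin n) (Fin n) A) :
    mnorm n (x.map fun a => (a : 𝓜(ℂ, A))) = mnorm n x := by
  obtain ⟨H, _, _, _, θ, -, h, h'⟩ := exists_rep_multiplier (A := A)
  rw [h, h']
  rfl

theorem multiplier_mnorm_one (m : 𝓜(ℂ, A)) : mnorm 1 (Matrix.of fun _ _ => m) = ‖m‖ := by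
  obtain ⟨H, _, _, _, θ, h, h', -⟩ := exists_rep_multiplier (A := A)
  rw [h', ← h]
  exact norm_matrixOp_of_const (θ m)

theorem norm_coe_multiplier (a : A) : ‖(a : 𝓜(ℂ, A))‖ = ‖a‖ := by
  rw [← multiplier_mnorm_one, ← OperatorAlgebra.mnorm_one, ← mnorm_coe]
  rfl

theorem mnorm_multiplier_mul_diagonal_le {n : ℕ} (x : Matrix (Fin n) (Fin n) 𝓜(ℂ, A)) (a : A) :
    mnorm n (Matrix.of fun i j => (x i j).fst a) ≤ mnorm n x * ‖a‖ := by
  obtain ⟨H, _, _, _, θ, h, h', h''⟩ := exists_rep_multiplier (A := A)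
  have hx : (Matrix.of fun i j => (x i j).fst a).map (fun a => θ (a : 𝓜(ℂ, A))) =
      x.map θ * Matrix.diagonal fun _ => θ (a : 𝓜(ℂ, A)) := by
    ext1 i j
    rw [Matrix.mul_diagonal, Matrix.map_apply, Matrix.map_apply, ← map_mul, Matrix.of_apply]
    congr 1
    refine DoubleCentralizer.ext ℂ A _ _ (Prod.ext ?_ ?_) <;> ext b
    · simp [DoubleCentralizer.fst_mul_apply]
    · simp [(x i j).central]
  rw [h'', hx, matrixOp_mul, h', ← norm_coe_multiplier, ← h]
  refine (ContinuousLinearMap.opNorm_comp_le _ _).trans ?_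
  gcongr
  exact norm_matrixOp_diagonal_le _

theorem isClosed_multiplierIdeal : IsClosed (multiplierIdeal A : Set 𝓜(ℂ, A)) := by
  have hiso : Isometry (DoubleCentralizer.coe ℂ : A → 𝓜(ℂ, A)) := by
    refine Isometry.of_dist_eq fun a b => ?_
    rw [dist_eq_norm, dist_eq_norm, ← norm_coe_multiplier]
    congr 1
    ext x <;> simp
  exact hiso.isClosedEmbedding.isClosed_range

end Multiplier

/-! ### The norm of an extension algebra -/

namespace Extension

variable {C A : Type u} [OperatorAlgebra C] [OperatorAlgebra A]

theorem σ_fst_apply (E : Extension C A) (b : E.B) (a : A) :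
    E.α ((E.σ b).fst a) = b * E.α a :=
  E.α_left b a

theorem σ_snd_apply (E : Extension C A) (b : E.B) (a : A) :
    E.α ((E.σ b).snd a) = E.α a * b :=
  E.α_right b a

theorem σ_α (E : Extension C A) (a : A) : E.σ (E.α a) = (a : 𝓜(ℂ, A)) := by
  ext x <;> apply E.α_injective
  · rw [σ_fst_apply, ← map_mul]; rfl
  · rw [σ_snd_apply, ← map_mul]; rfl

theorem β_α (E : Extension C A) (a : A) : E.β (E.α a) = 0 := (E.exact _).2 ⟨a, rfl⟩

variable [ApproximatelyUnital A]

/-- The essential subspace of the ideal reduces the extension algebra: on it the norm is that of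
the image in the multiplier algebra, and on its complement the ideal acts as zero. -/
theorem mnorm_eq_max (E : Extension C A) {n : ℕ} (x : Matrix (Fin n) (Fin n) E.B) :
    mnorm n x = max (mnorm n (x.map E.σ)) (mnorm n (x.map E.β)) := by
  refine le_antisymm ?_ (max_le (E.σ_contractive n x) (E.quotient.1 n x))
  refine le_of_forall_gt_imp_ge_of_dense fun r hr => ?_
  obtain ⟨hr₁, hr₂⟩ := max_lt_iff.1 hr
  -- A lift `y` of `β(x)` of norm below `r`. It differs from `x` by entries in `α(A)`, so both act
  -- alike where `A` acts as zero.
  obtain ⟨y, hyx, hy⟩ := E.quotient.2 n _ r hr₂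
  obtain ⟨H, _, _, _, π, hπ⟩ := OperatorAlgebra.exists_rep (A := E.B)
  obtain ⟨l, hl, hl'⟩ := ApproximatelyUnital.exists_cai (A := A)
  have := hl.neBot
  have hr0 : 0 ≤ r := (mnorm_nonneg _).trans hy.le
  set ρ : A →ₙₐ[ℂ] (H →L[ℂ] H) := π.comp E.α with hρdef
  have hρ (a : A) : ‖ρ a‖ ≤ ‖a‖ := ((norm_rep_apply hπ _).trans (E.norm_α a)).le
  have hcl := isClosed_essentialSubspace hρ hl'
  have : CompleteSpace (essentialSubspace ρ l) := hcl.completeSpace_coe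
  have hleft (b : E.B) (a : A) : π b * ρ a = ρ ((E.σ b).fst a) := by
    simp only [hρdef, NonUnitalAlgHom.comp_apply, σ_fst_apply, map_mul]
  have hright (b : E.B) (a : A) : ρ a * π b = ρ ((E.σ b).snd a) := by
    simp only [hρdef, NonUnitalAlgHom.comp_apply, σ_snd_apply, map_mul]
  have htend (b : E.B) {ξ : H} (hξ : ξ ∈ essentialSubspace ρ l) :
      Tendsto (fun e => ρ ((E.σ b).fst e) ξ) l (𝓝 (π b ξ)) := by
    simp only [← hleft]
    exact ((π b).continuous.tendsto _).comp hξ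
  rw [hπ]
  refine norm_matrixOp_le_of_reducing (essentialSubspace ρ l) _ hr0 (fun i j ξ hξ => ?_)
    (fun i j ζ hζ => ?_) (fun ξ hξ => ?_) (fun ζ hζ => ?_)
  · exact hcl.mem_of_tendsto (htend (x i j) hξ)
      (Eventually.of_forall fun e => apply_mem_essentialSubspace hρ hl _ _)
  -- Without adjoints, invariance of the complement is a separate matter. The component `v` of `π (x
  -- i j) ζ` in the essential subspace is killed by every `ρ e`, as `ρ e * π (x i j)` lies in
  -- `ρ(A)`; but `ρ e v → v`.
  · obtain ⟨v, hv, w, hw, hvw⟩ :=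
      (essentialSubspace ρ l).exists_add_mem_mem_orthogonal (π (x i j) ζ)
    have h0 (e : A) : ρ e v = 0 := by
      have h1 : ρ e (π (x i j) ζ) = 0 :=
        (DFunLike.congr_fun (hright (x i j) e) ζ).trans
          (apply_eq_zero_of_mem_orthogonal hρ hl hl' _ hζ)
      rwa [hvw, map_add, apply_eq_zero_of_mem_orthogonal hρ hl hl' _ hw, add_zero] at h1
    have hv0 : v = 0 := tendsto_nhds_unique (mem_essentialSubspace.1 hv) (by simp [h0])
    rw [Matrix.map_apply, hvw, hv0, zero_add]
    exact hw
  -- On the essential subspace `x` is the strong limit of `x · diag(e, …, e)`, whose entries lie in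
  -- `A` and whose norm is at most that of `σ(x)`.
  · refine norm_matrixOp_apply_le_of_tendsto
      (S := fun e => (Matrix.of fun i j => E.α ((E.σ (x i j)).fst e)).map π)
      (fun i j => htend (x i j) (hξ j)) (hl'.mono fun e he => ?_)
    rw [← hπ]
    refine (E.isometric n (Matrix.of fun i j => (E.σ (x i j)).fst e)).trans_le ?_
    refine (mnorm_multiplier_mul_diagonal_le (x.map E.σ) e).trans ?_
    refine (mul_le_of_le_one_right (multiplier_mnorm_nonneg _) he).trans hr₁.le
  · have h : matrixOp (x.map π) ζ = matrixOp (y.map π) ζ := by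
      ext i
      rw [matrixOp_apply, matrixOp_apply]
      refine Finset.sum_congr rfl fun j _ => ?_
      obtain ⟨a, ha⟩ := (E.exact (x i j - y i j)).1 (by
        rw [map_sub, sub_eq_zero]; exact (congrFun (congrFun hyx i) j).symm)
      have h1 : ρ a (ζ j) = 0 := apply_eq_zero_of_mem_orthogonal hρ hl hl' _ (hζ j)
      rw [hρdef, NonUnitalAlgHom.comp_apply, ha, map_sub, sub_apply,
        sub_eq_zero] at h1
      exact h1
    rw [h]
    refine ((matrixOp (y.map π)).le_opNorm ζ).trans ?_
    rw [← hπ]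
    gcongr

end Extension

/-! ### Direct sums of representations -/

section DirectSum

variable {H K : Type u} [NormedAddCommGroup H] [InnerProductSpace ℂ H]
  [NormedAddCommGroup K] [InnerProductSpace ℂ K]

/-- The direct sum of two bounded operators. -/
noncomputable def directSumOp (S : H →L[ℂ] H) (T : K →L[ℂ] K) :
    WithLp 2 (H × K) →L[ℂ] WithLp 2 (H × K) :=
  ((WithLp.prodContinuousLinearEquiv 2 ℂ H K).symm : H × K →L[ℂ] WithLp 2 (H × K)) ∘L
    (S.prodMap T) ∘L (WithLp.prodContinuousLinearEquiv 2 ℂ H K : WithLp 2 (H × K) →L[ℂ] H × K)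

theorem norm_matrixOp_directSumOp {n : ℕ} (S : Matrix (Fin n) (Fin n) (H →L[ℂ] H))
    (T : Matrix (Fin n) (Fin n) (K →L[ℂ] K)) :
    ‖matrixOp (Matrix.of fun i j => directSumOp (S i j) (T i j))‖ =
      max ‖matrixOp S‖ ‖matrixOp T‖ := by
  set R := Matrix.of fun i j => directSumOp (S i j) (T i j) with hR
  have split (ξ : PiLp 2 fun _ : Fin n => WithLp 2 (H × K)) :
      ‖ξ‖ ^ 2 = ‖(WithLp.toLp 2 fun i => (ξ i).fst : PiLp 2 fun _ : Fin n => H)‖ ^ 2 +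
        ‖(WithLp.toLp 2 fun i => (ξ i).snd : PiLp 2 fun _ : Fin n => K)‖ ^ 2 := by
    simp only [PiLp.norm_sq_eq_of_L2, WithLp.prod_norm_sq_eq_of_L2, Finset.sum_add_distrib]
  have hfst (ξ : PiLp 2 fun _ : Fin n => WithLp 2 (H × K)) :
      (WithLp.toLp 2 fun i => (matrixOp R ξ i).fst : PiLp 2 fun _ : Fin n => H) =
        matrixOp S (WithLp.toLp 2 fun i => (ξ i).fst) := by
    ext i
    simp only [matrixOp_apply, hR, Matrix.of_apply]
    exact (map_sum (WithLp.fstL 2 ℂ H K) _ _).trans rfl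
  have hsnd (ξ : PiLp 2 fun _ : Fin n => WithLp 2 (H × K)) :
      (WithLp.toLp 2 fun i => (matrixOp R ξ i).snd : PiLp 2 fun _ : Fin n => K) =
        matrixOp T (WithLp.toLp 2 fun i => (ξ i).snd) := by
    ext i
    simp only [matrixOp_apply, hR, Matrix.of_apply]
    exact (map_sum (WithLp.sndL 2 ℂ H K) _ _).trans rfl
  refine le_antisymm ?_ (max_le ?_ ?_)
  · have h0 : 0 ≤ max ‖matrixOp S‖ ‖matrixOp T‖ := le_max_of_le_left (norm_nonneg (matrixOp S))
    refine ContinuousLinearMap.opNorm_le_bound _ h0 fun ξ => ?_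
    refine le_of_sq_le_sq ?_ (by positivity)
    rw [mul_pow, split, split ξ, hfst, hsnd, mul_add, ← mul_pow, ← mul_pow]
    gcongr
    · exact ((matrixOp S).le_opNorm _).trans (by gcongr; exact le_max_left _ _)
    · exact ((matrixOp T).le_opNorm _).trans (by gcongr; exact le_max_right _ _)
  · refine ContinuousLinearMap.opNorm_le_bound _ (norm_nonneg (matrixOp R)) fun ξ => ?_
    let ζ : PiLp 2 fun _ : Fin n => WithLp 2 (H × K) :=
      WithLp.toLp 2 fun i => WithLp.toLp 2 (ξ i, 0)
    have hζ : ‖ζ‖ = ‖ξ‖ := by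
      simp [ζ, PiLp.norm_eq_of_L2]
    rw [← hζ]
    refine le_trans (le_of_sq_le_sq ?_ (norm_nonneg _)) ((matrixOp R).le_opNorm ζ)
    rw [split (matrixOp R ζ), hfst]
    exact le_add_of_nonneg_right (by positivity)
  · refine ContinuousLinearMap.opNorm_le_bound _ (norm_nonneg (matrixOp R)) fun ξ => ?_
    let ζ : PiLp 2 fun _ : Fin n => WithLp 2 (H × K) :=
      WithLp.toLp 2 fun i => WithLp.toLp 2 (0, ξ i)
    have hζ : ‖ζ‖ = ‖ξ‖ := by
      simp [ζ, PiLp.norm_eq_of_L2]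
    rw [← hζ]
    refine le_trans (le_of_sq_le_sq ?_ (norm_nonneg _)) ((matrixOp R).le_opNorm ζ)
    rw [split (matrixOp R ζ), hsnd]
    exact le_add_of_nonneg_left (by positivity)

variable {A C : Type u} [NonUnitalNonAssocSemiring A] [DistribMulAction ℂ A]
  [NonUnitalNonAssocSemiring C] [DistribMulAction ℂ C]

/-- The direct sum of two representations. -/
noncomputable def directSumRep (π : A →ₙₐ[ℂ] (H →L[ℂ] H)) (ρ : C →ₙₐ[ℂ] (K →L[ℂ] K)) :
    A × C →ₙₐ[ℂ] (WithLp 2 (H × K) →L[ℂ] WithLp 2 (H × K)) where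
  toFun p := directSumOp (π p.1) (ρ p.2)
  map_smul' c p := by
    ext ξ
    simp only [Prod.smul_fst, Prod.smul_snd, map_smul]
    rfl
  map_zero' := by
    ext ξ
    simp only [Prod.fst_zero, Prod.snd_zero, map_zero]
    rfl
  map_add' p q := by
    ext ξ
    simp only [Prod.fst_add, Prod.snd_add, map_add]
    rfl
  map_mul' p q := by
    ext ξ
    simp only [Prod.fst_mul, Prod.snd_mul, map_mul]
    rfl

end DirectSum

/-! ### The pullback as an operator algebra -/

section Pullback

variable {C A : Type u} [OperatorAlgebra C] [OperatorAlgebra A] [ApproximatelyUnital A]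

theorem coronaMap_eq_zero_iff {m : 𝓜(ℂ, A)} :
    coronaMap A m = 0 ↔ ∃ a : A, (a : 𝓜(ℂ, A)) = m :=
  Ideal.Quotient.eq_zero_iff_mem

theorem coronaMap_coe (a : A) : coronaMap A (a : 𝓜(ℂ, A)) = 0 := coronaMap_eq_zero_iff.2 ⟨a, rfl⟩

theorem coronaMap_surjective : Function.Surjective (coronaMap A) := Ideal.Quotient.mk_surjective

theorem mnorm_coronaMap_le {n : ℕ} (x : Matrix (Fin n) (Fin n) 𝓜(ℂ, A)) :
    mnorm n (x.map (coronaMap A)) ≤ mnorm n x := by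
  refine csInf_le ⟨0, ?_⟩ ⟨x, rfl, rfl⟩
  rintro _ ⟨y, -, rfl⟩
  exact Extension.multiplier_mnorm_nonneg y

theorem exists_coronaMap_lift {n : ℕ} {q : Matrix (Fin n) (Fin n) (Corona A)} {r : ℝ}
    (h : mnorm n q < r) :
    ∃ x : Matrix (Fin n) (Fin n) 𝓜(ℂ, A), x.map (coronaMap A) = q ∧ mnorm n x < r := by
  choose s hs using coronaMap_surjective (A := A)
  obtain ⟨_, ⟨x, hx, rfl⟩, hlt⟩ := exists_lt_of_csInf_lt
    (s := {r : ℝ | ∃ x : Matrix (Fin n) (Fin n) 𝓜(ℂ, A), x.map (coronaMap A) = q ∧ mnorm n x = r})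
    ⟨_, q.map s, by ext i j; exact hs _, rfl⟩ h
  exact ⟨x, hx, hlt⟩

/-- Contractivity of `τ` in a form that needs no topology on the corona; it drives the closedness of
the pullback. -/
theorem exists_norm_lift (τ : Mor C (Corona A)) {c : C} {r : ℝ} (h : ‖c‖ < r) :
    ∃ m : 𝓜(ℂ, A), coronaMap A m = τ.1 c ∧ ‖m‖ < r := by
  rw [← OperatorAlgebra.mnorm_one] at h
  obtain ⟨x, hx, hr⟩ := exists_coronaMap_lift ((τ.2 1 _).trans_lt h)
  refine ⟨x 0 0, congrFun (congrFun hx 0) 0, ?_⟩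
  rw [← multiplier_mnorm_one]
  refine (congrArg _ (Matrix.ext fun i j => ?_)).trans_lt hr
  rw [Subsingleton.elim i 0, Subsingleton.elim j 0, Matrix.of_apply]

theorem mem_coronaPullback {τ : Mor C (Corona A)} {p : 𝓜(ℂ, A) × C} :
    p ∈ coronaPullback τ ↔ coronaMap A p.1 = τ.1 p.2 := Iff.rfl

theorem isClosed_coronaPullback (τ : Mor C (Corona A)) :
    IsClosed (coronaPullback τ : Set (𝓜(ℂ, A) × C)) := by
  refine isClosed_of_closure_subset fun p hp => ?_
  obtain ⟨m₀, hm₀⟩ := coronaMap_surjective (τ.1 p.2)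
  have hmem : p.1 - m₀ ∈ closure (multiplierIdeal A : Set 𝓜(ℂ, A)) := by
    refine Metric.mem_closure_iff.2 fun ε hε => ?_
    obtain ⟨q, hq, hpq⟩ := Metric.mem_closure_iff.1 hp (ε / 2) (by positivity)
    rw [dist_eq_norm] at hpq
    obtain ⟨k, hk, hkn⟩ := exists_norm_lift τ ((norm_snd_le (p - q)).trans_lt hpq)
    -- The multiplier `k` is a small lift of `τ (p.2 - q.2)`, so `q.1 + k` lifts `τ p.2` exactly, as
    -- `m₀` does, and stays within `ε` of `p.1`.
    refine ⟨q.1 + k - m₀, Ideal.Quotient.eq_zero_iff_mem.1 ?_, ?_⟩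
    · change coronaMap A (q.1 + k - m₀) = 0
      rw [map_sub, map_add, hk, hm₀, mem_coronaPullback.1 hq, Prod.snd_sub, map_sub]
      abel
    · rw [dist_eq_norm, show p.1 - m₀ - (q.1 + k - m₀) = (p - q).1 - k by
        rw [Prod.fst_sub]; abel]
      linarith [norm_sub_le (p - q).1 k, norm_fst_le (p - q)]
  rw [isClosed_multiplierIdeal.closure_eq] at hmem
  have h : coronaMap A (p.1 - m₀) = 0 := Ideal.Quotient.eq_zero_iff_mem.2 hmem
  rwa [map_sub, hm₀, sub_eq_zero] at h

theorem pullback_mnorm_eq {τ : Mor C (Corona A)} {n : ℕ}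
    (x : Matrix (Fin n) (Fin n) (coronaPullback τ)) :
    mnorm n x = max (mnorm n (x.map fun p => p.1.1)) (mnorm n (x.map fun p => p.1.2)) := rfl

noncomputable instance pullbackOperatorAlgebra (τ : Mor C (Corona A)) :
    OperatorAlgebra (coronaPullback τ) where
  toNonUnitalNormedRing := inferInstance
  toCompleteSpace := (isClosed_coronaPullback τ).completeSpace_coe
  toNormedSpace := Submodule.normedSpace (coronaPullback τ).toSubmodule
  toIsScalarTower := inferInstance
  toSMulCommClass := inferInstance
  toMatrixNorms := pullbackMatrixNorms τ
  mnorm_one p := congrArg₂ max (multiplier_mnorm_one p.1.1) (OperatorAlgebra.mnorm_one p.1.2)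
  exists_rep := by
    obtain ⟨H, _, _, _, θ, -, hθ, -⟩ := exists_rep_multiplier (A := A)
    obtain ⟨K, _, _, _, π, hπ⟩ := OperatorAlgebra.exists_rep (A := C)
    refine ⟨WithLp 2 (H × K), inferInstance, inferInstance, inferInstance,
      (directSumRep θ π).comp (NonUnitalSubalgebraClass.subtype (coronaPullback τ)),
      fun n x => ?_⟩
    rw [pullback_mnorm_eq, hθ, hπ]
    exact (norm_matrixOp_directSumOp _ _).symm

end Pullback

/-- The canonical embedding `A → 𝓜(A)`. -/
noncomputable def multiplierInclusion (A : Type u) [OperatorAlgebra A] [ApproximatelyUnital A] :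
    A →ₙₐ[ℂ] 𝓜(ℂ, A) where
  toFun a := (a : 𝓜(ℂ, A))
  map_smul' c a := by ext x <;> simp
  map_zero' := by ext x <;> simp
  map_add' a b := by ext x <;> simp
  map_mul' a b := by ext x <;> simp [mul_assoc]

/-! ### Classification by the Busby invariant; split and unital extensions -/

section PullbackExtension

variable {C A : Type u} [OperatorAlgebra C] [OperatorAlgebra A]

theorem toClass_eq_toClass {E₁ E₂ : Extension C A} :
    E₁.toClass = E₂.toClass ↔ E₁.StronglyIsomorphic E₂ :=
  Quotient.eq (r := extensionSetoid C A)

variable [ApproximatelyUnital A]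

/-- The pullback extension constructed from `τ`. -/
noncomputable def pullbackExtension (τ : Mor C (Corona A)) : Extension C A where
  B := coronaPullback τ
  instB := pullbackOperatorAlgebra τ
  α :=
    { toFun := fun a => ⟨(multiplierInclusion A a, 0), by
        rw [mem_coronaPullback, map_zero]; exact coronaMap_coe a⟩
      map_smul' := fun c a => Subtype.ext (Prod.ext (map_smul _ c a) (smul_zero c).symm)
      map_zero' := Subtype.ext (Prod.ext (map_zero _) rfl)
      map_add' := fun a b => Subtype.ext (Prod.ext (map_add _ a b) (add_zero 0).symm)
      map_mul' := fun a b => Subtype.ext (Prod.ext (map_mul _ a b) (mul_zero 0).symm) }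
  β :=
    { toFun := fun p => p.1.2
      map_smul' := fun _ _ => rfl
      map_zero' := rfl
      map_add' := fun _ _ => rfl
      map_mul' := fun _ _ => rfl }
  isometric n x := by
    refine (max_eq_left ?_).trans (mnorm_coe x)
    refine le_of_eq_of_le ?_ (Extension.multiplier_mnorm_nonneg _)
    exact mnorm_zero_right
  exact := by
    rintro ⟨⟨m, c⟩, hp⟩
    constructor
    · intro hc
      obtain rfl : c = 0 := hc
      rw [mem_coronaPullback, map_zero] at hp
      obtain ⟨a, rfl⟩ := coronaMap_eq_zero_iff.1 hp
      exact ⟨a, rfl⟩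
    · rintro ⟨a, ha⟩
      exact (congrArg (fun p : coronaPullback τ => p.1.2) ha).symm
  quotient := by
    refine ⟨fun n x => le_max_right _ _, fun n y r hr => ?_⟩
    -- Complete contractivity of `τ` gives a lift of `τ(y)` with norm still below `r`, so pairing it
    -- with `y` does not exceed `r`.
    obtain ⟨x, hx, hxr⟩ := exists_coronaMap_lift ((τ.2 n y).trans_lt hr)
    exact ⟨Matrix.of fun i j => ⟨(x i j, y i j), congrFun (congrFun hx i) j⟩, rfl,
      max_lt hxr hr⟩

theorem isPullback_iff_stronglyIsomorphic {E : Extension C A} {τ : Mor C (Corona A)} :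
    E.IsPullback τ ↔ E.StronglyIsomorphic (pullbackExtension τ) := by
  constructor
  · rintro ⟨φ, h₁, h₂, h₃, h₄⟩
    exact ⟨φ, h₁, h₂, fun a => Subtype.ext (h₃ a), h₄⟩
  · rintro ⟨φ, h₁, h₂, h₃, h₄⟩
    exact ⟨φ, h₁, h₂, fun a => congrArg Subtype.val (h₃ a), h₄⟩

theorem Extension.isPullback_busby (E : Extension C A) : E.IsPullback E.busby := by
  refine ⟨{ toFun := fun b => ⟨(E.σ b, E.β b), (E.busbyHom_β b).symm⟩
            map_smul' := fun c b => Subtype.ext (Prod.ext (map_smul _ c b) (map_smul _ c b))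
            map_zero' := Subtype.ext (Prod.ext (map_zero _) (map_zero _))
            map_add' := fun b b' => Subtype.ext (Prod.ext (map_add _ b b') (map_add _ b b'))
            map_mul' := fun b b' => Subtype.ext (Prod.ext (map_mul _ b b') (map_mul _ b b')) },
    fun n x => (E.mnorm_eq_max x).symm, ?_, fun a => Prod.ext (E.σ_α a) (E.β_α a), fun b => rfl⟩
  rintro ⟨⟨m, c⟩, hp⟩
  obtain ⟨b, rfl⟩ := E.β_surjective c
  -- Any preimage `b` of `c` has the right second coordinate; the error in the first lies in `A` and
  -- is absorbed by adding an element of `α(A)`.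
  have hm : coronaMap A (m - E.σ b) = 0 := by
    rw [map_sub, sub_eq_zero, mem_coronaPullback.1 hp]
    exact E.busbyHom_β b
  obtain ⟨a, ha⟩ := coronaMap_eq_zero_iff.1 hm
  refine ⟨b + E.α a, Subtype.ext (Prod.ext ?_ ?_)⟩
  · change E.σ (b + E.α a) = m
    rw [map_add, E.σ_α, ha, add_sub_cancel]
  · change E.β (b + E.α a) = E.β b
    rw [map_add, E.β_α, add_zero]

/-- The canonical morphism of the pullback is its first projection, since `(m, c)(a, 0) = (m a, 0)`;
the defining relation of the pullback then reads off `τ`. -/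
theorem busby_pullbackExtension (τ : Mor C (Corona A)) : (pullbackExtension τ).busby = τ := by
  have hσ (p : coronaPullback τ) : (pullbackExtension τ).σ p = p.1.1 := by
    have h1 (a : A) : (((pullbackExtension τ).σ p).fst a : 𝓜(ℂ, A)) = (p.1.1.fst a : 𝓜(ℂ, A)) := by
      refine (congrArg (fun q : coronaPullback τ => q.1.1)
        ((pullbackExtension τ).σ_fst_apply p a)).trans ?_
      change p.1.1 * (a : 𝓜(ℂ, A)) = _
      ext x
      · simp [DoubleCentralizer.fst_mul_apply]
      · simp [p.1.1.central]
    have h2 (a : A) : (((pullbackExtension τ).σ p).snd a : 𝓜(ℂ, A)) = (p.1.1.snd a : 𝓜(ℂ, A)) := by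
      refine (congrArg (fun q : coronaPullback τ => q.1.1)
        ((pullbackExtension τ).σ_snd_apply p a)).trans ?_
      change (a : 𝓜(ℂ, A)) * p.1.1 = _
      ext x
      · simp [p.1.1.central]
      · simp [DoubleCentralizer.snd_mul_apply]
    exact DoubleCentralizer.ext ℂ A _ _ (Prod.ext
      (ContinuousLinearMap.ext fun a => DoubleCentralizer.coe_injective (h1 a))
      (ContinuousLinearMap.ext fun a => DoubleCentralizer.coe_injective (h2 a)))
  refine Subtype.ext (NonUnitalAlgHom.ext fun c => ?_)
  obtain ⟨p, rfl⟩ := (pullbackExtension τ).β_surjective c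
  exact ((pullbackExtension τ).busbyHom_β p).trans
    ((congrArg (coronaMap A) (hσ p)).trans (mem_coronaPullback.1 (Subtype.property p)))

theorem ExtClasses.busby_toClass (E : Extension C A) : ExtClasses.busby E.toClass = E.busby := rfl

theorem Extension.busby_eq_iff_isPullback (E : Extension C A) (τ : Mor C (Corona A)) :
    E.busby = τ ↔ E.IsPullback τ := by
  constructor
  · rintro rfl
    exact E.isPullback_busby
  · intro h
    rw [isPullback_iff_stronglyIsomorphic, ← toClass_eq_toClass] at h
    rw [← ExtClasses.busby_toClass, h, ExtClasses.busby_toClass, busby_pullbackExtension]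

theorem ExtClasses.busby_bijective :
    Function.Bijective (ExtClasses.busby : ExtClasses C A → Mor C (Corona A)) := by
  refine ⟨?_, fun τ => ⟨(pullbackExtension τ).toClass, busby_pullbackExtension τ⟩⟩
  rintro ⟨E₁⟩ ⟨E₂⟩ h
  have h₁ := isPullback_iff_stronglyIsomorphic.1 E₁.isPullback_busby
  have h₂ := isPullback_iff_stronglyIsomorphic.1 E₂.isPullback_busby
  rw [← toClass_eq_toClass] at h₁ h₂
  refine h₁.trans (Eq.trans ?_ h₂.symm)
  exact congrArg (fun τ => (pullbackExtension τ).toClass) h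

/-- A splitting `γ` gives `η = σ ∘ γ`. Conversely `c ↦ (η c, c)` splits the pullback, and is
completely contractive because the norm there is a maximum. -/
theorem Extension.isSplit_iff (E : Extension C A) :
    E.IsSplit ↔ ∃ η : Mor C 𝓜(ℂ, A), ∀ c, E.busby.1 c = coronaMap A (η.1 c) := by
  constructor
  · rintro ⟨γ, hγ⟩
    refine ⟨⟨E.σ.comp γ.1, fun n x => (E.σ_contractive n (x.map γ.1)).trans (γ.2 n x)⟩,
      fun c => ?_⟩
    refine Eq.trans ?_ (E.busbyHom_β (γ.1 c))
    rw [hγ]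
    rfl
  · rintro ⟨η, hη⟩
    obtain ⟨φ, hφ, -, -, hβ⟩ := (extensionSetoid C A).symm
      (isPullback_iff_stronglyIsomorphic.1 E.isPullback_busby)
    let γ : C →ₙₐ[ℂ] (pullbackExtension E.busby).B :=
      { toFun := fun c => (⟨(η.1 c, c), (hη c).symm⟩ : coronaPullback E.busby)
        map_smul' := fun z c => Subtype.ext (Prod.ext (map_smul η.1 z c) rfl)
        map_zero' := Subtype.ext (Prod.ext (map_zero η.1) rfl)
        map_add' := fun c d => Subtype.ext (Prod.ext (map_add η.1 c d) rfl)
        map_mul' := fun c d => Subtype.ext (Prod.ext (map_mul η.1 c d) rfl) }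
    refine ⟨⟨φ.comp γ, fun n x => (hφ n (x.map γ)).trans_le ?_⟩, fun c => hβ (γ c)⟩
    exact max_le (η.2 n x) le_rfl

/-- The morphism `π_A ∘ η`. -/
noncomputable def coronaComp (η : Mor C 𝓜(ℂ, A)) : Mor C (Corona A) :=
  ⟨(coronaMap A : 𝓜(ℂ, A) →ₙₐ[ℂ] Corona A).comp η.1,
    fun n x => (mnorm_coronaMap_le (x.map η.1)).trans (η.2 n x)⟩

theorem exists_map_onto_split_classes :
    ∃ Φ : Mor C 𝓜(ℂ, A) → ExtClasses C A,
      (∀ η c, (ExtClasses.busby (Φ η)).1 c = coronaMap A (η.1 c)) ∧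
      Set.range Φ = {x | ∃ E : Extension C A, E.toClass = x ∧ E.IsSplit} := by
  have hΦ (η : Mor C 𝓜(ℂ, A)) (c : C) :
      (pullbackExtension (coronaComp η)).busby.1 c = coronaMap A (η.1 c) := by
    rw [busby_pullbackExtension]
    rfl
  refine ⟨fun η => (pullbackExtension (coronaComp η)).toClass, hΦ, Set.ext fun x => ⟨?_, ?_⟩⟩
  · rintro ⟨η, rfl⟩
    exact ⟨_, rfl, (Extension.isSplit_iff _).2 ⟨η, hΦ η⟩⟩
  · rintro ⟨E, rfl, hE⟩
    obtain ⟨η, hη⟩ := E.isSplit_iff.1 hE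
    refine ⟨η, ExtClasses.busby_bijective.1 (Subtype.ext (NonUnitalAlgHom.ext fun c => ?_))⟩
    exact (hΦ η c).trans (hη c).symm

/-- The canonical inclusion and the zero morphism both become zero in the corona. -/
theorem exists_ne_coronaMap_comp_eq [Nontrivial A] :
    ∃ η₁ η₂ : Mor A 𝓜(ℂ, A), η₁ ≠ η₂ ∧ ∀ a, coronaMap A (η₁.1 a) = coronaMap A (η₂.1 a) := by
  have hzero : CompletelyContractive (0 : A →ₙₐ[ℂ] 𝓜(ℂ, A)) := fun n x => by
    refine le_of_eq_of_le ?_ (mnorm_nonneg x)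
    refine Eq.trans ?_ ((mnorm_coe (0 : Matrix (Fin n) (Fin n) A)).trans mnorm_zero_right)
    exact congrArg _ (Matrix.ext fun i j => (map_zero (multiplierInclusion A)).symm)
  refine ⟨⟨multiplierInclusion A, fun n x => (mnorm_coe x).le⟩, ⟨0, hzero⟩, fun h => ?_,
    fun a => (coronaMap_coe a).trans (map_zero (coronaMap A)).symm⟩
  obtain ⟨a, ha⟩ := exists_ne (0 : A)
  have h1 : multiplierInclusion A a = 0 := DFunLike.congr_fun (congrArg Subtype.val h) a
  exact ha (DoubleCentralizer.coe_injective (h1.trans (map_zero (multiplierInclusion A)).symm))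

theorem busby_apply_of_isUnital {E : Extension C A} (hE : IsUnital E.B) {e : C}
    (he : IsUnitElement e) : E.busby.1 e = 1 := by
  obtain ⟨f, -, hf⟩ := hE
  have hfe : E.β f = e := by
    obtain ⟨b, rfl⟩ := E.β_surjective e
    rw [← (he.2 (E.β f)).2, ← map_mul, (hf b).1]
  have hσ : E.σ f = 1 := by
    ext a <;> apply E.α_injective
    · rw [E.σ_fst_apply, (hf _).1]; rfl
    · rw [E.σ_snd_apply, (hf _).2]; rfl
  have h := E.busbyHom_β f
  rw [hfe, hσ, map_one] at h
  exact h

theorem isUnital_pullbackExtension {τ : Mor C (Corona A)} {e : C} (he : IsUnitElement e)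
    (hτ : τ.1 e = 1) : IsUnital (pullbackExtension τ).B := by
  have hmem : ((1, e) : 𝓜(ℂ, A) × C) ∈ coronaPullback τ := by
    rw [mem_coronaPullback, hτ, map_one]
  refine ⟨(⟨(1, e), hmem⟩ : coronaPullback τ), ?_, fun p => ⟨?_, ?_⟩⟩
  -- Only `‖1‖ ≤ 1` is needed in `𝓜(A)`: the second coordinate `e` already has norm one.
  · refine (max_eq_right ?_).trans he.1
    refine le_of_le_of_eq ?_ he.1.symm
    exact max_le ContinuousLinearMap.norm_id_le ContinuousLinearMap.norm_id_le
  · exact Subtype.ext (Prod.ext (one_mul (Subtype.val p).1) (he.2 (Subtype.val p).2).1)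
  · exact Subtype.ext (Prod.ext (mul_one (Subtype.val p).1) (he.2 (Subtype.val p).2).2)

theorem bijOn_busby_unital {e : C} (he : IsUnitElement e) :
    Set.BijOn (ExtClasses.busby : ExtClasses C A → Mor C (Corona A))
      {x | ∃ E : Extension C A, E.toClass = x ∧ IsUnital E.B} {τ | τ.1 e = 1} := by
  refine ⟨?_, ExtClasses.busby_bijective.1.injOn, fun τ hτ => ?_⟩
  · rintro _ ⟨E, rfl, hE⟩
    exact busby_apply_of_isUnital hE he
  · exact ⟨_, ⟨_, rfl, isUnital_pullbackExtension he hτ⟩, busby_pullbackExtension τ⟩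

end PullbackExtension

theorem theorem3p3 (C A : Type u) [OperatorAlgebra C] [Nontrivial C] [OperatorAlgebra A]
    [Nontrivial A] [ApproximatelyUnital A] :
    -- the Busby invariant is a bijection, with inverse given by the pullback extension
    Function.Bijective (ExtClasses.busby : ExtClasses C A → Mor C (Corona A)) ∧
    (∀ (E : Extension C A) (τ : Mor C (Corona A)), E.busby = τ ↔ E.IsPullback τ) ∧
    -- split extensions
    (∀ E : Extension C A, E.IsSplit ↔
      ∃ η : Mor C 𝓜(ℂ, A), ∀ c, E.busby.1 c = coronaMap A (η.1 c)) ∧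
    (∃ Φ : Mor C 𝓜(ℂ, A) → ExtClasses C A,
      (∀ η c, (ExtClasses.busby (Φ η)).1 c = coronaMap A (η.1 c)) ∧
      Set.range Φ = {x | ∃ E : Extension C A, E.toClass = x ∧ E.IsSplit}) ∧
    -- that correspondence is not injective in general
    (∃ η₁ η₂ : Mor A 𝓜(ℂ, A), η₁ ≠ η₂ ∧ ∀ a, coronaMap A (η₁.1 a) = coronaMap A (η₂.1 a)) ∧
    -- unital extensions
    (∀ e : C, IsUnitElement e →
      Set.BijOn (ExtClasses.busby : ExtClasses C A → Mor C (Corona A))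
        {x | ∃ E : Extension C A, E.toClass = x ∧ IsUnital E.B}
        {τ | τ.1 e = 1}) := by
  exact ⟨ExtClasses.busby_bijective, Extension.busby_eq_iff_isPullback, Extension.isSplit_iff,
    exists_map_onto_split_classes, exists_ne_coronaMap_comp_eq, fun _ he => bijOn_busby_unital he⟩
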